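/- Let $A\in\mathbb R^{n\times n}$ be a nonzero symmetric positive semidefinite matrix, $b\in\mathbb R^n$, $\tau\ge 0$, $f(x)=\frac12x^TAx-b^Tx$ and $F(x)=f(x)+\tau\|x\|_1$, and assume that $\min_{x\in\mathbb R^n}F(x)$ has an optimal solution. Let $\|A\|$ be the spectral norm and $\|\cdot\|$ the Euclidean norm. For $x\in\mathbb R^n$ put $I_0(x)=\{i:x_i=0\}$, $I_-(x)=\{i:x_i<0\}$, $I_+(x)=\{i:x_i>0\}$, $\mathcal H(x)=\{y:y_i=0,\ i\in I_0(x)\}$, $F^*_x=\min_{\mathcal H(x)}F$; let $v(x)$ be the minimum-norm element of $\partial F(x)$, let $v^P(x)$ agree with $v(x)$ on $I_0(x)$ and vanish elsewhere, and let $c(x)\in\{-\tau,0,\tau\}^n$ be given by $c_i(x)=\tau$ if $x_i>0$, or $x_i=0$ and $\nabla_if(x)+\tau<0$; $c_i(x)=-\tau$ if $x_i<0$, or $x_i=0$ and $\nabla_if(x)-\tau>0$; $c_i(x)=0$ otherwise. Subroutine $\mathrm{TPCG1}(A,b,c,J_0,J_-,J_+,x^0,\delta)$. Let $\Omega=\{x:x_{J_0}=0,\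 x_{J_-}\le 0,\ x_{J_+}\ge 0\}$ and let $P$ be the orthogonal projection onto $\{x:x_{J_0}=0\}$. Start with $r^0=Ax^0-b+c$, $p^0=Pr^0$, $d^0=-p^0$. For $k=0,1,\dots$: put $\alpha^{cg}_k=\|p^k\|^2/((d^k)^TAd^k)$ ($=\infty$ if the denominator is $0$ and $p^k\ne0$), $\alpha^{tc}_k=\max\{\alpha:x^k+\alpha d^k\in\Omega\}$, $\alpha_k=\min(\alpha^{cg}_k,\alpha^{tc}_k)$, $x^{k+1}=x^k+\alpha_kd^k$; if $\alpha^{cg}_k>\alpha_k$, return $x^{k+1}$; put $r^{k+1}=r^k+\alpha_kAd^k$, $p^{k+1}=Pr^{k+1}$; if $\|p^{k+1}\|_\infty\le\delta$, return $x^{k+1}$; put $d^{k+1}=-p^{k+1}+\frac{\|p^{k+1}\|^2}{\|p^k\|^2}d^k$. GCG method 4. Input: $A,b,\tau$, $x^0\in\mathbb R^n$, $t\in(0,2/\|A\|)$, $\eta_0>0$, $\rho>1$, $0<\xi<1$, $\varepsilon\ge0$. Start with $\hat\eta=\eta_0$, $\hat\varepsilon=\varepsilon$, $\mathcal C=\emptyset$.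 For $k=0,1,\dots$: 1. If $\|v(x^k)\|_\infty\le\varepsilon$, return $y=x^k$. 2. If $\|[v(x^k)]_{I_0(x^k)}\|>\sqrt{\hat\eta}\,\|[v(x^k)]_{I_0(x^k)^c}\|$, set $\hat\varepsilon\leftarrow\varepsilon$, and then: if some member of $\mathcal C$ is a subset of $I_0(x^k)$, set $\hat\eta\leftarrow\rho\hat\eta$, $\mathcal C\leftarrow\emptyset$, $x^{k+1}=x^k$; if not, set $\mathcal C\leftarrow\mathcal C\cup\{I_0(x^k)\}$ and $x^{k+1}=x^k-\frac{\|v^P(x^k)\|^2}{v^P(x^k)^TAv^P(x^k)}v^P(x^k)$. 3. Otherwise set $y^{k+1}=\mathrm{TPCG1}\Big(A,b,c(x^k),I_0(x^k),I_-(x^k),I_+(x^k),x^k,\frac{\sqrt{(2t^{-1}-\|A\|)\|A\|}\;\hat\varepsilon}{(t^{-1}+\|A\|)\sqrt{n\hat\eta}}\Big)$, $x^{k+1}=\arg\min\{\frac12\|x-(y^{k+1}-t(Ay^{k+1}-b))\|^2+t\tau\|x\|_1:x\in\mathcal H(y^{k+1})\}$ and $\hat\varepsilon\leftarrow\xi\hat\varepsilon$.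 There is a smallest $\eta^*\ge0$ such that $F(x)-F^*_x\le\frac{\eta^*}{2\|A\|}\|[v(x)]_{I_0(x)^c}\|^2$ for all $x$ with $F(x)\le F(x^0)$, the method is well defined (every iteration that does not stop has exactly one successor; in particular every call of TPCG1 terminates), and, with $\log 0=-\infty$: (i) The method terminates at an iteration $k$ with $$k\le\max\left(\left\lceil\frac{\log\eta^*-\log\eta_0}{\log\rho}\right\rceil+1,1\right)\bigl(1+(M+1)(2^n-1)\bigr),\qquad M=\max\left(\left\lceil\frac{\min(\log\eta_0-\log\eta^*,-\log\eta^*)}{2\log\xi}\right\rceil+n+1,\ n+1\right).$$ (ii) The output $y$ satisfies $s\in\partial F(y)$ for some $s$ with $\|s\|_\infty\le\varepsilon$, and $y$ minimizes $F$ if $\varepsilon=0$. -/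

import Mathlib

open scoped Matrix

namespace GCG

noncomputable section

/-! ### The problem `min F(x) = ½ xᵀAx - bᵀx + τ‖x‖₁` -/

/-- `f(x) = ½ xᵀAx - bᵀx`. -/
def quad {n : ℕ} (A : Matrix (Fin n) (Fin n) ℝ) (b x : Fin n → ℝ) : ℝ :=
  (1 / 2) * (x ⬝ᵥ A *ᵥ x) - b ⬝ᵥ x

/-- `∇f(x) = Ax - b`. -/
def grad {n : ℕ} (A : Matrix (Fin n) (Fin n) ℝ) (b x : Fin n → ℝ) : Fin n → ℝ :=
  A *ᵥ x - b

/-- `F(x) = f(x) + τ‖x‖₁`. -/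
def objective {n : ℕ} (A : Matrix (Fin n) (Fin n) ℝ) (b : Fin n → ℝ) (τ : ℝ)
    (x : Fin n → ℝ) : ℝ :=
  quad A b x + τ * ∑ i, |x i|

/-- `x` is an optimal solution of `min F`. -/
def IsOptimal {n : ℕ} (A : Matrix (Fin n) (Fin n) ℝ) (b : Fin n → ℝ) (τ : ℝ)
    (x : Fin n → ℝ) : Prop :=
  ∀ z, objective A b τ x ≤ objective A b τ z

/-- The convex subdifferential `∂F(x)`. -/
def subdiff {n : ℕ} (A : Matrix (Fin n) (Fin n) ℝ) (b : Fin n → ℝ) (τ : ℝ)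
    (x : Fin n → ℝ) : Set (Fin n → ℝ) :=
  {s | ∀ z, objective A b τ x + s ⬝ᵥ (z - x) ≤ objective A b τ z}

/-- The spectral norm `‖A‖`, i.e. the operator norm for the Euclidean norm. -/
def specNorm {n : ℕ} (A : Matrix (Fin n) (Fin n) ℝ) : ℝ :=
  ‖Matrix.toEuclideanCLM (n := Fin n) (𝕜 := ℝ) A‖

/-- `I₀(x)`. -/
def zeros {n : ℕ} (x : Fin n → ℝ) : Finset (Fin n) := Finset.univ.filter fun i => x i = 0

/-- `I₋(x)`. -/
def negs {n : ℕ} (x : Fin n → ℝ) : Finset (Fin n) := Finset.univ.filter fun i => x i < 0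

/-- `I₊(x)`. -/
def poss {n : ℕ} (x : Fin n → ℝ) : Finset (Fin n) := Finset.univ.filter fun i => 0 < x i

/-- The Euclidean norm `‖v_J‖` of the subvector of `v` indexed by `J`. -/
def subNorm {n : ℕ} (J : Finset (Fin n)) (v : Fin n → ℝ) : ℝ := √(∑ i ∈ J, v i ^ 2)

/-- The coordinate subspace `{y : y_i = 0 for i ∈ J}`; `ℋ(x)` is `coordSubspace (zeros x)`. -/
def coordSubspace {n : ℕ} (J : Finset (Fin n)) : Set (Fin n → ℝ) := {y | ∀ i ∈ J, y i = 0}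

/-- The orthogonal projection onto `coordSubspace J`. -/
def coordProj {n : ℕ} (J : Finset (Fin n)) (r : Fin n → ℝ) : Fin n → ℝ :=
  fun i => if i ∈ J then 0 else r i

/-- `F*_x = min {F(y) : y ∈ ℋ(x)}`. -/
def faceMin {n : ℕ} (A : Matrix (Fin n) (Fin n) ℝ) (b : Fin n → ℝ) (τ : ℝ)
    (x : Fin n → ℝ) : ℝ :=
  sInf (objective A b τ '' coordSubspace (zeros x))

/-- The minimum-norm subgradient `v(x)` of `F` at `x`: the projection of `0` onto `∂F(x)`. -/
def minSubgrad {n : ℕ} (A : Matrix (Fin n) (Fin n) ℝ) (b : Fin n → ℝ) (τ : ℝ)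
    (x : Fin n → ℝ) : Fin n → ℝ :=
  fun i =>
    if x i = 0 then min (grad A b x i + τ) (max 0 (grad A b x i - τ))
    else grad A b x i + τ * Real.sign (x i)

/-- The projected minimum-norm subgradient: `v(x)` restricted to the zero components of `x`. -/
def projSubgrad {n : ℕ} (A : Matrix (Fin n) (Fin n) ℝ) (b : Fin n → ℝ) (τ : ℝ)
    (x : Fin n → ℝ) : Fin n → ℝ :=
  fun i => if x i = 0 then minSubgrad A b τ x i else 0

/-- The vector `c(x; τ) ∈ {-τ, 0, τ}ⁿ`. -/
def signVec {n : ℕ} (A : Matrix (Fin n) (Fin n) ℝ) (b : Fin n → ℝ) (τ : ℝ)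
    (x : Fin n → ℝ) : Fin n → ℝ :=
  fun i =>
    if 0 < x i ∨ (x i = 0 ∧ grad A b x i + τ < 0) then τ
    else if x i < 0 ∨ (x i = 0 ∧ 0 < grad A b x i - τ) then -τ
    else 0

/-- The constants `η ≥ 0` with `F(x) - F*_x ≤ η / (2‖A‖) · ‖v(x)_{I₀ᶜ(x)}‖²` for all `x` such that
`F(x) ≤ F(x⁰)`. -/
def errorBoundConstants {n : ℕ} (A : Matrix (Fin n) (Fin n) ℝ) (b : Fin n → ℝ) (τ : ℝ)
    (x0 : Fin n → ℝ) : Set ℝ :=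
  {η | 0 ≤ η ∧ ∀ x, objective A b τ x ≤ objective A b τ x0 →
    objective A b τ x - faceMin A b τ x ≤
      η / (2 * specNorm A) * subNorm (zeros x)ᶜ (minSubgrad A b τ x) ^ 2}

/-! ### The truncated projected CG subroutine TPCG1 -/

/-- The feasible set `Ω = {x : x_{J₀} = 0, x_{J₋} ≤ 0, x_{J₊} ≥ 0}`. -/
def feasible {n : ℕ} (J0 Jm Jp : Finset (Fin n)) : Set (Fin n → ℝ) :=
  {x | (∀ j ∈ J0, x j = 0) ∧ (∀ j ∈ Jm, x j ≤ 0) ∧ ∀ j ∈ Jp, 0 ≤ x j}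

/-- The vectors `xᵏ, rᵏ, pᵏ, dᵏ`. -/
structure CGState (n : ℕ) where
  x : Fin n → ℝ
  r : Fin n → ℝ
  p : Fin n → ℝ
  d : Fin n → ℝ

/-- `r⁰ = Ax⁰ - b + c`, `p⁰ = P_ℋ(r⁰)`, `d⁰ = -p⁰`. -/
def cgInit {n : ℕ} (A : Matrix (Fin n) (Fin n) ℝ) (b c : Fin n → ℝ) (J0 : Finset (Fin n))
    (x0 : Fin n → ℝ) : CGState n where
  x := x0
  r := A *ᵥ x0 - b + c
  p := coordProj J0 (A *ᵥ x0 - b + c)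
  d := -coordProj J0 (A *ᵥ x0 - b + c)

/-- `α^cg = ‖p‖² / (dᵀAd)`, and `∞` if `dᵀAd = 0` (it is used only when `p ≠ 0`). -/
def cgLength {n : ℕ} (A : Matrix (Fin n) (Fin n) ℝ) (s : CGState n) : EReal :=
  if s.d ⬝ᵥ A *ᵥ s.d = 0 then ⊤ else (((s.p ⬝ᵥ s.p) / (s.d ⬝ᵥ A *ᵥ s.d) : ℝ) : EReal)

/-- `α^tc = max {α : x + αd ∈ Ω}`, which is `∞` if these `α` are unbounded above. -/
def tcLength {n : ℕ} (J0 Jm Jp : Finset (Fin n)) (s : CGState n) : EReal :=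
  sSup ((fun α : ℝ => (α : EReal)) '' {α : ℝ | s.x + α • s.d ∈ feasible J0 Jm Jp})

/-- The step length `α = min {α^cg, α^tc}` is well defined, finite and equal to `α`. -/
def IsStepLength {n : ℕ} (A : Matrix (Fin n) (Fin n) ℝ) (J0 Jm Jp : Finset (Fin n))
    (s : CGState n) (α : ℝ) : Prop :=
  s.p ≠ 0 ∧ (α : EReal) = min (cgLength A s) (tcLength J0 Jm Jp s)

/-- `x⁺ = x + αd`, `r⁺ = r + αAd`, `p⁺ = P_ℋ(r⁺)`, `d⁺ = -p⁺ + (‖p⁺‖² / ‖p‖²) d`. -/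
def cgNext {n : ℕ} (A : Matrix (Fin n) (Fin n) ℝ) (J0 : Finset (Fin n))
    (s : CGState n) (α : ℝ) : CGState n where
  x := s.x + α • s.d
  r := s.r + α • (A *ᵥ s.d)
  p := coordProj J0 (s.r + α • (A *ᵥ s.d))
  d := -coordProj J0 (s.r + α • (A *ᵥ s.d)) +
    ((coordProj J0 (s.r + α • (A *ᵥ s.d)) ⬝ᵥ coordProj J0 (s.r + α • (A *ᵥ s.d))) /
      (s.p ⬝ᵥ s.p)) • s.d

/-- `CGReturns A J0 Jm Jp δ s y`: the loop of TPCG1 with tolerance `δ`, entered in the state `s`,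
terminates after finitely many passes and returns `y`. The norm of `Fin n → ℝ` is `‖·‖_∞`. -/
inductive CGReturns {n : ℕ} (A : Matrix (Fin n) (Fin n) ℝ) (J0 Jm Jp : Finset (Fin n)) (δ : ℝ) :
    CGState n → (Fin n → ℝ) → Prop
  | boundary (s : CGState n) (α : ℝ) (hα : IsStepLength A J0 Jm Jp s α)
      (hlt : (α : EReal) < cgLength A s) :
      CGReturns A J0 Jm Jp δ s (s.x + α • s.d)
  | converged (s : CGState n) (α : ℝ) (hα : IsStepLength A J0 Jm Jp s α)
      (hge : ¬ (α : EReal) < cgLength A s) (htol : ‖(cgNext A J0 s α).p‖ ≤ δ) :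
      CGReturns A J0 Jm Jp δ s (s.x + α • s.d)
  | advance (s : CGState n) (α : ℝ) (y : Fin n → ℝ) (hα : IsStepLength A J0 Jm Jp s α)
      (hge : ¬ (α : EReal) < cgLength A s) (htol : ¬ ‖(cgNext A J0 s α).p‖ ≤ δ)
      (hrest : CGReturns A J0 Jm Jp δ (cgNext A J0 s α) y) :
      CGReturns A J0 Jm Jp δ s y

/-- `y = TPCG1(A, b, c, J₀, J₋, J₊, x⁰, δ)`. -/
def TPCG1 {n : ℕ} (A : Matrix (Fin n) (Fin n) ℝ) (b c : Fin n → ℝ) (J0 Jm Jp : Finset (Fin n))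
    (x0 : Fin n → ℝ) (δ : ℝ) (y : Fin n → ℝ) : Prop :=
  CGReturns A J0 Jm Jp δ (cgInit A b c J0 x0) y

/-! ### GCG method 4 -/

/-- The iterate `xᵏ` and the current values of the variables `η̂`, `ε̂` and `𝒞`. -/
structure State (n : ℕ) where
  x : Fin n → ℝ
  etaHat : ℝ
  epsHat : ℝ
  family : Finset (Finset (Fin n))

/-- The termination test `‖v(xᵏ)‖_∞ ≤ ε`. -/
def Stops {n : ℕ} (A : Matrix (Fin n) (Fin n) ℝ) (b : Fin n → ℝ) (τ ε : ℝ) (s : State n) : Prop :=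
  ‖minSubgrad A b τ s.x‖ ≤ ε

/-- The test `‖v(x)_{I₀(x)}‖ > √η̂ ‖v(x)_{I₀ᶜ(x)}‖`. -/
def ReleaseTest {n : ℕ} (A : Matrix (Fin n) (Fin n) ℝ) (b : Fin n → ℝ) (τ : ℝ) (s : State n) : Prop :=
  √s.etaHat * subNorm (zeros s.x)ᶜ (minSubgrad A b τ s.x) <
    subNorm (zeros s.x) (minSubgrad A b τ s.x)

/-- The tolerance `√((2/t - ‖A‖)‖A‖) ε̂ / ((1/t + ‖A‖) √(n η̂))` passed to TPCG1. -/
def cgTol {n : ℕ} (A : Matrix (Fin n) (Fin n) ℝ) (t : ℝ) (s : State n) : ℝ :=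
  √((2 * t⁻¹ - specNorm A) * specNorm A) * s.epsHat /
    ((t⁻¹ + specNorm A) * √((n : ℝ) * s.etaHat))

/-- The objective `½‖x - (y - t(Ay - b))‖² + tτ‖x‖₁` of the proximal gradient step. -/
def proxObjective {n : ℕ} (A : Matrix (Fin n) (Fin n) ℝ) (b : Fin n → ℝ) (τ t : ℝ)
    (y x : Fin n → ℝ) : ℝ :=
  (1 / 2) * ∑ i, (x i - (y i - t * grad A b y i)) ^ 2 + t * τ * ∑ i, |x i|

/-- One pass through the loop of the method that is not stopped by the termination test. -/
inductive Step {n : ℕ} (A : Matrix (Fin n) (Fin n) ℝ) (b : Fin n → ℝ) (τ t ρ ξ ε : ℝ) :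
    State n → State n → Prop
  | enlarge (s : State n) (hrun : ¬ Stops A b τ ε s) (hmeas : ReleaseTest A b τ s)
      (hmem : ∃ S ∈ s.family, S ⊆ zeros s.x) :
      Step A b τ t ρ ξ ε s ⟨s.x, ρ * s.etaHat, ε, ∅⟩
  | lineSearch (s : State n) (hrun : ¬ Stops A b τ ε s) (hmeas : ReleaseTest A b τ s)
      (hmem : ¬ ∃ S ∈ s.family, S ⊆ zeros s.x)
      (hden : projSubgrad A b τ s.x ⬝ᵥ A *ᵥ projSubgrad A b τ s.x ≠ 0) :
      Step A b τ t ρ ξ ε s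
        ⟨s.x - ((projSubgrad A b τ s.x ⬝ᵥ projSubgrad A b τ s.x) /
            (projSubgrad A b τ s.x ⬝ᵥ A *ᵥ projSubgrad A b τ s.x)) • projSubgrad A b τ s.x,
          s.etaHat, ε, insert (zeros s.x) s.family⟩
  | cgProx (s : State n) (y x' : Fin n → ℝ) (hrun : ¬ Stops A b τ ε s)
      (hmeas : ¬ ReleaseTest A b τ s)
      (hcg : TPCG1 A b (signVec A b τ s.x) (zeros s.x) (negs s.x) (poss s.x) s.x (cgTol A t s) y)
      (hface : x' ∈ coordSubspace (zeros y))
      (hprox : ∀ z ∈ coordSubspace (zeros y),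
        proxObjective A b τ t y x' ≤ proxObjective A b τ t y z) :
      Step A b τ t ρ ξ ε s ⟨x', s.etaHat, ξ * s.epsHat, s.family⟩

/-- `Reaches … k s`: after `k` passes through the loop, none of them stopped by the termination
test, the method started from `x⁰`, `η̂ = η₀`, `ε̂ = ε`, `𝒞 = ∅` is in the state `s`. -/
inductive Reaches {n : ℕ} (A : Matrix (Fin n) (Fin n) ℝ) (b : Fin n → ℝ) (τ : ℝ)
    (x0 : Fin n → ℝ) (t η0 ρ ξ ε : ℝ) : ℕ → State n → Prop
  | init : Reaches A b τ x0 t η0 ρ ξ ε 0 ⟨x0, η0, ε, ∅⟩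
  | step (k : ℕ) (s s' : State n) (hs : Reaches A b τ x0 t η0 ρ ξ ε k s)
      (hstep : Step A b τ t ρ ξ ε s s') : Reaches A b τ x0 t η0 ρ ξ ε (k + 1) s'

/-- `y = GCG4(A, b, τ, x⁰, t, η₀, ρ, ξ, ε)`, returned by the termination test at iteration `k`. -/
def Returns {n : ℕ} (A : Matrix (Fin n) (Fin n) ℝ) (b : Fin n → ℝ) (τ : ℝ)
    (x0 : Fin n → ℝ) (t η0 ρ ξ ε : ℝ) (k : ℕ) (y : Fin n → ℝ) : Prop :=
  ∃ s, Reaches A b τ x0 t η0 ρ ξ ε k s ∧ Stops A b τ ε s ∧ y = s.x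

/-! ### The iteration bound -/

/-- `max(⌈(log η* - log η₀) / log ρ⌉ + 1, 1)`, where `log 0 = -∞`. -/
def phaseBound (ηs η0 ρ : ℝ) : ℤ :=
  if ηs = 0 then 1 else max (⌈(Real.log ηs - Real.log η0) / Real.log ρ⌉ + 1) 1

/-- `M = max(⌈min(log η₀ - log η*, -log η*) / (2 log ξ)⌉ + n + 1, n + 1)`, where `log 0 = -∞`. -/
def runBound (n : ℕ) (ηs η0 ξ : ℝ) : ℤ :=
  if ηs = 0 then (n : ℤ) + 1
  else max (⌈min (Real.log η0 - Real.log ηs) (-Real.log ηs) / (2 * Real.log ξ)⌉ + n + 1) (n + 1)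

/-- `max(⌈(log η* - log η₀) / log ρ⌉ + 1, 1) · (1 + (M + 1)(2ⁿ - 1))`. -/
def iterationBound (n : ℕ) (ηs η0 ρ ξ : ℝ) : ℤ :=
  phaseBound ηs η0 ρ * (1 + (runBound n ηs η0 ξ + 1) * (2 ^ n - 1))

end

end GCG

namespace GCG

variable {n : ℕ} {A : Matrix (Fin n) (Fin n) ℝ} {b : Fin n → ℝ} {τ : ℝ}

/-! ### Quadratic forms and the spectral norm -/

/-! No pass increases `F`, so all iterates stay in the sublevel set of `x0`, where the error bound
is available. The rest is a count of passes.

The constant η* exists because on each of the finitely many sign patterns `F` agrees with a convex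
quadratic (`exists_errorBound_of_sign`, `exists_isLeast_errorBoundConstants`). A call of TPCG1 ends
because its nonzero projected residuals are mutually orthogonal (`CGInv.next`, `CGInv.finrank_lt`).

A release of zero coordinates at `x` lowers `F` by more than η̂/(2‖A‖) times the squared free part
of `v(x)` (`lineSearch_spec`). If η* ≤ η̂, this drops `F` below its minimum on ℋ(x), so no later
iterate lies in ℋ(x). A recurring face therefore proves η̂ < η*, which bounds the number of
enlargements.

Call the passes between enlargements a phase. Its releases have distinct nonempty zero sets, at most
N = 2ⁿ - 1 of them. In a run of CG and proximal steps the zero set only grows. A step that leaves it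
unchanged met the CG tolerance, and the error bound turns this into a bound on the free part of `v`
proportional to ε̂ (`cgProx_spec`). Since ε̂ shrinks by ξ, such a step after `K` others leads to a
stop or a release, so a run has at most `K + n` passes; here `M = K + n + 1`.

A phase thus costs at most N(K+n+1) + K + n + 1 passes. This exceeds the budget `B = 1 + (K+n+2)N`
by at most `K`, and only if the zero set of the origin is released in it. Afterwards `F` stays below
`F(0)`, so that overdraft occurs once. The last phase repays it: once η* ≤ η̂ the runs are shorter,
and before that a whole further phase is still unspent (`LoopInv.enlarge`, `LoopInv.le_mul`). -/

lemma form_comm (hA : A.PosSemidef) (u w : Fin n → ℝ) : u ⬝ᵥ A *ᵥ w = w ⬝ᵥ A *ᵥ u := by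
  have h : Aᵀ = A := by simpa using hA.isHermitian.eq
  rw [Matrix.dotProduct_mulVec, ← Matrix.mulVec_transpose, h, dotProduct_comm]

lemma form_nonneg (hA : A.PosSemidef) (x : Fin n → ℝ) : 0 ≤ x ⬝ᵥ A *ᵥ x := by
  simpa using hA.dotProduct_mulVec_nonneg x

lemma dotProduct_self_nonneg (x : Fin n → ℝ) : 0 ≤ x ⬝ᵥ x :=
  Finset.sum_nonneg fun i _ => mul_self_nonneg (x i)

lemma form_le (A : Matrix (Fin n) (Fin n) ℝ) (x : Fin n → ℝ) :
    x ⬝ᵥ A *ᵥ x ≤ specNorm A * (x ⬝ᵥ x) := by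
  have h1 := real_inner_le_norm (WithLp.toLp 2 x)
    (Matrix.toEuclideanCLM (n := Fin n) (𝕜 := ℝ) A (WithLp.toLp 2 x))
  have h2 := (Matrix.toEuclideanCLM (n := Fin n) (𝕜 := ℝ) A).le_opNorm (WithLp.toLp 2 x)
  have h3 : x ⬝ᵥ x = ‖WithLp.toLp 2 x‖ ^ 2 := by
    rw [EuclideanSpace.real_norm_sq_eq]
    simp [dotProduct, sq]
  have h4 : x ⬝ᵥ A *ᵥ x = inner ℝ (WithLp.toLp 2 x)
      (Matrix.toEuclideanCLM (n := Fin n) (𝕜 := ℝ) A (WithLp.toLp 2 x)) := by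
    rw [Matrix.toEuclideanCLM_toLp, EuclideanSpace.inner_toLp_toLp, dotProduct_comm]
    simp
  rw [h3, h4]
  unfold specNorm
  nlinarith [norm_nonneg (WithLp.toLp 2 x)]

lemma specNorm_pos (hA0 : A ≠ 0) : 0 < specNorm A := by
  unfold specNorm
  rw [norm_pos_iff]
  simpa using hA0

/-- This is `A² ≤ ‖A‖ A`, obtained without diagonalization from nonnegativity of the form at `x -
‖A‖⁻¹ A x` and `form_le` at `A x`. -/
lemma mulVec_sq_le (hA : A.PosSemidef) (x : Fin n → ℝ) :
    (A *ᵥ x) ⬝ᵥ (A *ᵥ x) ≤ specNorm A * (x ⬝ᵥ A *ᵥ x) := by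
  by_cases hA0 : A = 0
  · subst hA0; simp
  have hL := specNorm_pos hA0
  set L := specNorm A with hLdef
  have h1 := form_nonneg hA (x - L⁻¹ • (A *ᵥ x))
  have h2 := form_le A (A *ᵥ x)
  have h3 : (A *ᵥ x) ⬝ᵥ A *ᵥ x = x ⬝ᵥ A *ᵥ (A *ᵥ x) := by rw [form_comm hA x]
  simp only [Matrix.mulVec_sub, Matrix.mulVec_smul, sub_dotProduct, dotProduct_sub,
    smul_dotProduct, dotProduct_smul, smul_eq_mul, ← h3] at h1
  rw [← hLdef] at h2
  have h4 : L⁻¹ * (L⁻¹ * ((A *ᵥ x) ⬝ᵥ A *ᵥ (A *ᵥ x))) ≤ L⁻¹ * ((A *ᵥ x) ⬝ᵥ (A *ᵥ x)) := by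
    have : L⁻¹ * (L⁻¹ * (L * ((A *ᵥ x) ⬝ᵥ (A *ᵥ x)))) = L⁻¹ * ((A *ᵥ x) ⬝ᵥ (A *ᵥ x)) := by
      field_simp
    rw [← this]
    gcongr
  have h5 : L⁻¹ * ((A *ᵥ x) ⬝ᵥ (A *ᵥ x)) ≤ x ⬝ᵥ A *ᵥ x := by linarith
  calc _ = L * (L⁻¹ * ((A *ᵥ x) ⬝ᵥ (A *ᵥ x))) := by field_simp
    _ ≤ _ := by gcongr

/-! ### Coordinate projections -/

lemma coordProj_mem (J : Finset (Fin n)) (r : Fin n → ℝ) : coordProj J r ∈ coordSubspace J := by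
  intro i hi
  simp [coordProj, hi]

lemma coordProj_add (J : Finset (Fin n)) (r s : Fin n → ℝ) :
    coordProj J (r + s) = coordProj J r + coordProj J s := by
  ext i
  by_cases h : i ∈ J <;> simp [coordProj, h]

lemma coordProj_smul (J : Finset (Fin n)) (a : ℝ) (r : Fin n → ℝ) :
    coordProj J (a • r) = a • coordProj J r := by
  ext i
  by_cases h : i ∈ J <;> simp [coordProj, h]

lemma coordProj_of_mem {J : Finset (Fin n)} {u : Fin n → ℝ} (hu : u ∈ coordSubspace J) :
    coordProj J u = u := by
  ext i
  by_cases h : i ∈ J <;> simp [coordProj, h]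
  exact (hu i h).symm

lemma coordProj_dotProduct {J : Finset (Fin n)} (r : Fin n → ℝ) {u : Fin n → ℝ}
    (hu : u ∈ coordSubspace J) : coordProj J r ⬝ᵥ u = r ⬝ᵥ u := by
  refine Finset.sum_congr rfl fun i _ => ?_
  by_cases h : i ∈ J
  · simp [hu i h]
  · simp [coordProj, h]

lemma dotProduct_coordProj {J : Finset (Fin n)} (r : Fin n → ℝ) {u : Fin n → ℝ}
    (hu : u ∈ coordSubspace J) : u ⬝ᵥ coordProj J r = u ⬝ᵥ r := by
  rw [dotProduct_comm, coordProj_dotProduct r hu, dotProduct_comm]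

lemma coordProj_sq (J : Finset (Fin n)) (r : Fin n → ℝ) :
    coordProj J r ⬝ᵥ coordProj J r = ∑ i ∈ Jᶜ, r i ^ 2 := by
  have h : Jᶜ = Finset.univ.filter (· ∉ J) := by ext; simp
  rw [h, Finset.sum_filter]
  refine Finset.sum_congr rfl fun i _ => ?_
  by_cases hi : i ∈ J <;> simp [coordProj, hi, sq]

lemma subNorm_sq (J : Finset (Fin n)) (v : Fin n → ℝ) : subNorm J v ^ 2 = ∑ i ∈ J, v i ^ 2 :=
  Real.sq_sqrt (Finset.sum_nonneg fun i _ => sq_nonneg (v i))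

/-! ### The objective -/

lemma quad_add (hA : A.PosSemidef) (b x z : Fin n → ℝ) :
    quad A b (x + z) = quad A b x + grad A b x ⬝ᵥ z + 1 / 2 * (z ⬝ᵥ A *ᵥ z) := by
  simp only [quad, grad, Matrix.mulVec_add, dotProduct_add, add_dotProduct, sub_dotProduct]
  rw [form_comm hA x z, dotProduct_comm (A *ᵥ x) z]
  ring

lemma grad_add (A : Matrix (Fin n) (Fin n) ℝ) (b x z : Fin n → ℝ) :
    grad A b (x + z) = grad A b x + A *ᵥ z := by
  simp only [grad, Matrix.mulVec_add]
  abel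

lemma quad_sub_right (A : Matrix (Fin n) (Fin n) ℝ) (b c x : Fin n → ℝ) :
    quad A (b - c) x = quad A b x + c ⬝ᵥ x := by
  simp only [quad, sub_dotProduct]
  ring

/-- Replacing the ℓ¹ term by a linear form turns `F` into a quadratic with shifted `b`: a minorant
in general, exact where `c` is a subgradient. The error bound, the CG model and the proximal
estimate all rest on this. -/
lemma quad_sub_right_le_objective {c : Fin n → ℝ} {x : Fin n → ℝ}
    (h : ∀ i, c i * x i ≤ τ * |x i|) : quad A (b - c) x ≤ objective A b τ x := by
  rw [quad_sub_right, objective, Finset.mul_sum]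
  exact add_le_add le_rfl (Finset.sum_le_sum fun i _ => h i)

lemma quad_sub_right_eq_objective {c : Fin n → ℝ} {x : Fin n → ℝ}
    (h : ∀ i, c i * x i = τ * |x i|) : quad A (b - c) x = objective A b τ x := by
  rw [quad_sub_right, objective, Finset.mul_sum]
  exact congrArg _ (Finset.sum_congr rfl fun i _ => h i)

lemma mem_zeros {x : Fin n → ℝ} {i : Fin n} : i ∈ zeros x ↔ x i = 0 := by simp [zeros]

lemma mem_coordSubspace_zeros (x : Fin n → ℝ) : x ∈ coordSubspace (zeros x) :=
  fun _ hi => mem_zeros.1 hi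

lemma zeros_subset_of_mem {x : Fin n → ℝ} {J : Finset (Fin n)} (h : x ∈ coordSubspace J) :
    J ⊆ zeros x :=
  fun i hi => mem_zeros.2 (h i hi)

lemma mem_coordSubspace_of_subset {x : Fin n → ℝ} {J : Finset (Fin n)} (h : J ⊆ zeros x) :
    x ∈ coordSubspace J :=
  fun _ hi => mem_zeros.1 (h hi)

/-- The optimal solution supplies the lower bound without which the `sInf` in `faceMin` would carry
no information. -/
lemma faceMin_le (hopt : ∃ xs, IsOptimal A b τ xs) {x z : Fin n → ℝ}
    (hz : z ∈ coordSubspace (zeros x)) : faceMin A b τ x ≤ objective A b τ z := by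
  obtain ⟨xs, hxs⟩ := hopt
  refine csInf_le ⟨objective A b τ xs, ?_⟩ ⟨z, hz, rfl⟩
  rintro _ ⟨w, -, rfl⟩
  exact hxs w

lemma le_faceMin {x : Fin n → ℝ} {a : ℝ}
    (h : ∀ z ∈ coordSubspace (zeros x), a ≤ objective A b τ z) : a ≤ faceMin A b τ x := by
  refine le_csInf ⟨_, x, mem_coordSubspace_zeros x, rfl⟩ ?_
  rintro _ ⟨w, hw, rfl⟩
  exact h w hw

/-! ### The minimum-norm subgradient -/

lemma minSubgrad_of_ne {x : Fin n → ℝ} {i : Fin n} (h : x i ≠ 0) :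
    minSubgrad A b τ x i = grad A b x i + τ * Real.sign (x i) := by
  simp [minSubgrad, h]

lemma sign_mul_self_eq_abs (a : ℝ) : Real.sign a * a = |a| := by
  rcases lt_trichotomy a 0 with h | h | h
  · rw [Real.sign_of_neg h, abs_of_neg h]; ring
  · simp [h]
  · rw [Real.sign_of_pos h, abs_of_pos h]; ring

lemma abs_sign_le_one (a : ℝ) : |Real.sign a| ≤ 1 := by
  rcases Real.sign_apply_eq a with h | h | h <;> simp [h]

/-- Together with `minSubgrad_sub_grad_mul` this says that `v - ∇f` is a subgradient of the ℓ¹ term.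
-/
lemma abs_minSubgrad_sub_grad_le (hτ : 0 ≤ τ) (x : Fin n → ℝ) (i : Fin n) :
    |minSubgrad A b τ x i - grad A b x i| ≤ τ := by
  by_cases h : x i = 0
  · simp only [minSubgrad, h, if_true]
    rw [abs_le]
    rcases min_cases (grad A b x i + τ) (max 0 (grad A b x i - τ)) with h1 | h1 <;>
      rcases max_cases 0 (grad A b x i - τ) with h2 | h2 <;> constructor <;> linarith
  · rw [minSubgrad_of_ne h, add_sub_cancel_left, abs_mul, abs_of_nonneg hτ]
    exact mul_le_of_le_one_right hτ (abs_sign_le_one _)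

lemma minSubgrad_sub_grad_mul (x : Fin n → ℝ) (i : Fin n) :
    (minSubgrad A b τ x i - grad A b x i) * x i = τ * |x i| := by
  by_cases h : x i = 0
  · simp [h]
  · rw [minSubgrad_of_ne h, add_sub_cancel_left, mul_assoc, sign_mul_self_eq_abs]

lemma mul_le_mul_abs_of_abs_le {a c : ℝ} (h : |a| ≤ c) (z : ℝ) : a * z ≤ c * |z| := by
  calc a * z ≤ |a * z| := le_abs_self _
    _ = |a| * |z| := abs_mul _ _
    _ ≤ c * |z| := by gcongr

theorem minSubgrad_mem_subdiff (hA : A.PosSemidef) (hτ : 0 ≤ τ) (x : Fin n → ℝ) :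
    minSubgrad A b τ x ∈ subdiff A b τ x := by
  intro z
  have h1 : quad A (b - (minSubgrad A b τ x - grad A b x)) z ≤ objective A b τ z :=
    quad_sub_right_le_objective fun i =>
      mul_le_mul_abs_of_abs_le (abs_minSubgrad_sub_grad_le hτ x i) _
  have h2 : quad A (b - (minSubgrad A b τ x - grad A b x)) x = objective A b τ x :=
    quad_sub_right_eq_objective fun i => minSubgrad_sub_grad_mul x i
  have h3 := quad_add hA (b - (minSubgrad A b τ x - grad A b x)) x (z - x)
  have h4 : grad A (b - (minSubgrad A b τ x - grad A b x)) x = minSubgrad A b τ x := by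
    simp only [grad]
    abel
  rw [h4, h2, add_sub_cancel] at h3
  have := form_nonneg hA (z - x)
  linarith

theorem isOptimal_of_minSubgrad_eq_zero (hA : A.PosSemidef) (hτ : 0 ≤ τ) {x : Fin n → ℝ}
    (h : minSubgrad A b τ x = 0) : IsOptimal A b τ x := by
  intro z
  have := minSubgrad_mem_subdiff (b := b) hA hτ x z
  simpa [h] using this

/-! ### The steepest descent step on the zero components -/

lemma grad_mul_projSubgrad (hτ : 0 ≤ τ) (x : Fin n → ℝ) (i : Fin n) :
    τ * |projSubgrad A b τ x i| - grad A b x i * projSubgrad A b τ x i =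
      -(projSubgrad A b τ x i * projSubgrad A b τ x i) := by
  by_cases h : x i = 0
  · simp only [projSubgrad, minSubgrad, h, if_true]
    rcases lt_or_ge (grad A b x i + τ) 0 with h1 | h1
    · rw [min_eq_left (h1.le.trans (le_max_left _ _)), abs_of_neg h1]
      ring
    · rcases lt_or_ge 0 (grad A b x i - τ) with h2 | h2
      · rw [max_eq_right h2.le, min_eq_right (by linarith), abs_of_pos h2]
        ring
      · rw [max_eq_left h2, min_eq_right h1]
        simp
  · simp [projSubgrad, h]

/-- Only zero coordinates move, so the absolute values simply add and `F` is exactly quadratic along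
the half-line. -/
lemma objective_sub_smul_projSubgrad (hA : A.PosSemidef) (hτ : 0 ≤ τ) (x : Fin n → ℝ) {a : ℝ}
    (ha : 0 ≤ a) :
    objective A b τ (x - a • projSubgrad A b τ x) = objective A b τ x -
      a * (projSubgrad A b τ x ⬝ᵥ projSubgrad A b τ x) +
      a ^ 2 / 2 * (projSubgrad A b τ x ⬝ᵥ A *ᵥ projSubgrad A b τ x) := by
  set v := projSubgrad A b τ x with hv
  have h1 : quad A b (x - a • v) = quad A b x - a * (grad A b x ⬝ᵥ v) +
      a ^ 2 / 2 * (v ⬝ᵥ A *ᵥ v) := by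
    rw [sub_eq_add_neg, ← neg_smul, quad_add hA]
    simp only [Matrix.mulVec_smul, smul_dotProduct, dotProduct_smul, smul_eq_mul]
    ring
  have h2 : ∀ i, |(x - a • v) i| = |x i| + a * |v i| := by
    intro i
    by_cases h : x i = 0
    · simp [h, abs_mul, abs_of_nonneg ha]
    · simp [hv, projSubgrad, h]
  have h3 : τ * ∑ i, |v i| - grad A b x ⬝ᵥ v = -(v ⬝ᵥ v) := by
    rw [Finset.mul_sum, dotProduct, dotProduct, ← Finset.sum_sub_distrib, ← Finset.sum_neg_distrib]
    exact Finset.sum_congr rfl fun i _ => grad_mul_projSubgrad hτ x i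
  simp only [objective, h1, h2, Finset.sum_add_distrib, ← Finset.mul_sum]
  linear_combination a * h3

lemma projSubgrad_sq (x : Fin n → ℝ) :
    projSubgrad A b τ x ⬝ᵥ projSubgrad A b τ x =
      subNorm (zeros x) (minSubgrad A b τ x) ^ 2 := by
  rw [subNorm_sq, zeros, Finset.sum_filter]
  refine Finset.sum_congr rfl fun i _ => ?_
  by_cases h : x i = 0 <;> simp [projSubgrad, h, sq]

/-- A direction of zero curvature along which `F` decreases would make `F` unbounded below. -/
lemma form_projSubgrad_ne_zero (hA : A.PosSemidef) (hτ : 0 ≤ τ)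
    (hopt : ∃ xs, IsOptimal A b τ xs) {x : Fin n → ℝ}
    (hv : 0 < projSubgrad A b τ x ⬝ᵥ projSubgrad A b τ x) :
    projSubgrad A b τ x ⬝ᵥ A *ᵥ projSubgrad A b τ x ≠ 0 := by
  intro h0
  obtain ⟨xs, hxs⟩ := hopt
  set q := projSubgrad A b τ x ⬝ᵥ projSubgrad A b τ x with hq
  -- With zero curvature the decrease is `a * q`; this `a` makes it one more than the gap to the
  -- minimum.
  set a := (objective A b τ x - objective A b τ xs + 1) / q with ha
  have ha0 : 0 ≤ a := div_nonneg (by linarith [hxs x]) hv.le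
  have h1 := objective_sub_smul_projSubgrad (b := b) hA hτ x ha0
  have h2 : a * q = objective A b τ x - objective A b τ xs + 1 := by
    rw [ha]; field_simp
  rw [h0, ← hq, h2] at h1
  linarith [hxs (x - a • projSubgrad A b τ x)]

/-- The step minimizes the exact quadratic along the half-line and gains `q²/(2a)`, where `q` is the
squared length and `a` the curvature; `form_le` bounds `a` by `‖A‖ q`. -/
theorem objective_lineSearch_le (hA : A.PosSemidef) (hA0 : A ≠ 0) (hτ : 0 ≤ τ) {x : Fin n → ℝ}
    (hden : projSubgrad A b τ x ⬝ᵥ A *ᵥ projSubgrad A b τ x ≠ 0) :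
    objective A b τ (x - ((projSubgrad A b τ x ⬝ᵥ projSubgrad A b τ x) /
        (projSubgrad A b τ x ⬝ᵥ A *ᵥ projSubgrad A b τ x)) • projSubgrad A b τ x) ≤
      objective A b τ x -
        (projSubgrad A b τ x ⬝ᵥ projSubgrad A b τ x) / (2 * specNorm A) := by
  have hpos := (form_nonneg hA (projSubgrad A b τ x)).lt_of_ne hden.symm
  have hq := dotProduct_self_nonneg (projSubgrad A b τ x)
  have hle := form_le A (projSubgrad A b τ x)
  have hL := specNorm_pos hA0
  rw [objective_sub_smul_projSubgrad hA hτ x (div_nonneg hq hpos.le)]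
  set q := projSubgrad A b τ x ⬝ᵥ projSubgrad A b τ x
  set a := projSubgrad A b τ x ⬝ᵥ A *ᵥ projSubgrad A b τ x
  have h1 : q / a * q - (q / a) ^ 2 / 2 * a = q * (q / (2 * a)) := by
    field_simp
    ring
  have h2 : q / (2 * specNorm A) ≤ q * (q / (2 * a)) := by
    rw [← mul_div_assoc, div_le_div_iff₀ (by positivity) (by positivity)]
    nlinarith
  linarith

/-! ### The error bound constant -/

/-- The quadratic form of a symmetric map is bounded by a multiple of the squared norm of its image. -/
lemma exists_dotProduct_le_of_symm (T : (Fin n → ℝ) →ₗ[ℝ] (Fin n → ℝ))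
    (hT : ∀ u w, u ⬝ᵥ T w = T u ⬝ᵥ w) :
    ∃ C : ℝ, 0 ≤ C ∧ ∀ u, u ⬝ᵥ T u ≤ C * (T u ⬝ᵥ T u) := by
  -- A linear right inverse on the range replaces `u` by `S (T u)`, whose size is controlled by `T
  -- u`; by symmetry this does not change `u ⬝ᵥ T u`.
  obtain ⟨S, hS⟩ := T.rangeRestrict.exists_rightInverse_of_surjective T.range_rangeRestrict
  set S' := LinearMap.toContinuousLinearMap S
  refine ⟨n * ‖S'‖, by positivity, fun u => ?_⟩
  set y := T.rangeRestrict u with hy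
  have h1 : T (S y) = T u := congrArg Subtype.val (LinearMap.congr_fun hS y)
  have h2 : u ⬝ᵥ T u = T u ⬝ᵥ S y := by rw [← h1, hT, h1]
  have hyn : ‖y‖ = ‖T u‖ := rfl
  have h3 : ‖S y‖ ≤ ‖S'‖ * ‖T u‖ := by simpa [hyn, S'] using S'.le_opNorm y
  have h4 : ‖T u‖ ^ 2 ≤ T u ⬝ᵥ T u := by
    have : ‖T u‖ ≤ √(T u ⬝ᵥ T u) := by
      refine (pi_norm_le_iff_of_nonneg (Real.sqrt_nonneg _)).2 fun i => ?_
      refine Real.abs_le_sqrt ?_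
      rw [sq]
      exact Finset.single_le_sum (f := fun i => T u i * T u i)
        (fun j _ => mul_self_nonneg _) (Finset.mem_univ i)
    calc _ ≤ √(T u ⬝ᵥ T u) ^ 2 := by gcongr
      _ = _ := Real.sq_sqrt (dotProduct_self_nonneg _)
  calc u ⬝ᵥ T u = ∑ i, T u i * S y i := h2
    _ ≤ ∑ _i : Fin n, ‖T u‖ * (‖S'‖ * ‖T u‖) := by
        refine Finset.sum_le_sum fun i _ => ?_
        calc T u i * S y i ≤ ‖T u i‖ * ‖S y i‖ := by
              rw [← norm_mul]; exact Real.le_norm_self _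
          _ ≤ _ := by
              gcongr
              · exact norm_le_pi_norm _ i
              · exact (norm_le_pi_norm _ i).trans h3
    _ = n * ‖S'‖ * ‖T u‖ ^ 2 := by simp; ring
    _ ≤ _ := by gcongr

/-- A finite-dimensional range is closed, so a point off it has positive distance. The distance is
taken in the sup norm, which the Euclidean norm dominates. -/
lemma exists_le_sq_dist_of_notMem_range (T : (Fin n → ℝ) →ₗ[ℝ] (Fin n → ℝ)) {c : Fin n → ℝ}
    (hc : c ∉ LinearMap.range T) :
    ∃ m : ℝ, 0 < m ∧ ∀ u, m ≤ (T u - c) ⬝ᵥ (T u - c) := by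
  have hcl : IsClosed (LinearMap.range T : Set (Fin n → ℝ)) :=
    (LinearMap.range T).closed_of_finiteDimensional
  have hpos : 0 < Metric.infDist c (LinearMap.range T) :=
    (hcl.notMem_iff_infDist_pos ⟨0, zero_mem _⟩).1 hc
  refine ⟨Metric.infDist c (LinearMap.range T) ^ 2, by positivity, fun u => ?_⟩
  have h1 : Metric.infDist c (LinearMap.range T) ≤ ‖T u - c‖ := by
    rw [← dist_eq_norm, dist_comm]
    exact Metric.infDist_le_dist_of_mem ⟨u, rfl⟩
  have h2 : ‖T u - c‖ ≤ √((T u - c) ⬝ᵥ (T u - c)) := by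
    refine (pi_norm_le_iff_of_nonneg (Real.sqrt_nonneg _)).2 fun i => ?_
    refine Real.abs_le_sqrt ?_
    rw [sq]
    exact Finset.single_le_sum (f := fun i => (T u - c) i * (T u - c) i)
      (fun j _ => mul_self_nonneg _) (Finset.mem_univ i)
  calc _ ≤ √((T u - c) ⬝ᵥ (T u - c)) ^ 2 := by gcongr; exact h1.trans h2
    _ = _ := Real.sq_sqrt (dotProduct_self_nonneg _)

/-- The compression of `A` to a coordinate subspace. -/
noncomputable def compression (A : Matrix (Fin n) (Fin n) ℝ) (J : Finset (Fin n)) :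
    (Fin n → ℝ) →ₗ[ℝ] (Fin n → ℝ) where
  toFun u := coordProj J (A *ᵥ coordProj J u)
  map_add' u w := by simp only [coordProj_add, Matrix.mulVec_add]
  map_smul' a u := by simp only [coordProj_smul, Matrix.mulVec_smul, RingHom.id_apply]

lemma compression_symm (hA : A.PosSemidef) (J : Finset (Fin n)) (u w : Fin n → ℝ) :
    u ⬝ᵥ compression A J w = compression A J u ⬝ᵥ w := by
  have h1 : ∀ u w : Fin n → ℝ, u ⬝ᵥ compression A J w = coordProj J u ⬝ᵥ A *ᵥ coordProj J w := by
    intro u w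
    change u ⬝ᵥ coordProj J (A *ᵥ coordProj J w) = _
    rw [← coordProj_dotProduct u (coordProj_mem J _), dotProduct_coordProj _ (coordProj_mem J _)]
  rw [h1, dotProduct_comm (compression A J u), h1, form_comm hA]

/-- The error bound for a convex quadratic model on a coordinate subspace: the suboptimality is
controlled by the reduced gradient, unless the reduced gradient is bounded away from zero. -/
lemma quad_sub_le_or_le_sq (hA : A.PosSemidef) (b : Fin n → ℝ) (J : Finset (Fin n)) :
    (∃ C : ℝ, 0 ≤ C ∧ ∀ x ∈ coordSubspace J, ∀ z ∈ coordSubspace J,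
      quad A b x - quad A b z ≤ C * ∑ i ∈ Jᶜ, grad A b x i ^ 2) ∨
    ∃ m : ℝ, 0 < m ∧ ∀ x ∈ coordSubspace J, m ≤ ∑ i ∈ Jᶜ, grad A b x i ^ 2 := by
  have hg : ∀ x ∈ coordSubspace J, ∑ i ∈ Jᶜ, grad A b x i ^ 2 =
      (compression A J x - coordProj J b) ⬝ᵥ (compression A J x - coordProj J b) := by
    intro x hx
    have : compression A J x - coordProj J b = coordProj J (grad A b x) := by
      change coordProj J (A *ᵥ coordProj J x) - _ = _
      rw [coordProj_of_mem hx, sub_eq_add_neg, ← neg_one_smul ℝ, ← coordProj_smul, ← coordProj_add,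
        neg_one_smul, ← sub_eq_add_neg]
      rfl
    rw [this, coordProj_sq]
  -- The dichotomy is whether the reduced stationarity equation on the subspace has a solution.
  by_cases hb : coordProj J b ∈ LinearMap.range (compression A J)
  · left
    obtain ⟨C, hC, hCle⟩ := exists_dotProduct_le_of_symm _ (compression_symm hA J)
    obtain ⟨w, hw⟩ := hb
    refine ⟨C / 2, by positivity, fun x hx z hz => ?_⟩
    rw [hg x hx, ← hw, ← map_sub]
    -- Completing the square at the solution `w`; `w` need not lie in the subspace, since the
    -- compression projects it first.
    have hw' : ∀ u ∈ coordSubspace J, quad A b u =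
        1 / 2 * ((u - w) ⬝ᵥ compression A J (u - w)) - 1 / 2 * (w ⬝ᵥ compression A J w) := by
      intro u hu
      have h1 : u ⬝ᵥ compression A J u = u ⬝ᵥ A *ᵥ u := by
        change u ⬝ᵥ coordProj J (A *ᵥ coordProj J u) = _
        rw [coordProj_of_mem hu, dotProduct_coordProj _ hu]
      have h2 : u ⬝ᵥ compression A J w = b ⬝ᵥ u := by
        rw [hw, dotProduct_coordProj _ hu, dotProduct_comm]
      have h3 : w ⬝ᵥ compression A J u = u ⬝ᵥ compression A J w := by
        rw [compression_symm hA, dotProduct_comm]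
      simp only [map_sub, dotProduct_sub, sub_dotProduct, h1, h3, h2, quad]
      ring
    have h4 := hCle (x - w)
    have h5 : 0 ≤ (z - w) ⬝ᵥ compression A J (z - w) := by
      change 0 ≤ (z - w) ⬝ᵥ coordProj J (A *ᵥ coordProj J (z - w))
      rw [← coordProj_dotProduct _ (coordProj_mem J _),
        dotProduct_coordProj _ (coordProj_mem J _)]
      exact form_nonneg hA _
    rw [hw' x hx, hw' z hz]
    linarith
  · right
    obtain ⟨m, hm, hmle⟩ := exists_le_sq_dist_of_notMem_range _ hb
    exact ⟨m, hm, fun x hx => by rw [hg x hx]; exact hmle x⟩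

/-- On the pattern σ, `F` equals the quadratic tilted by `c`, which lies below `F` everywhere, so
the face minimum may be compared with the quadratic. If its reduced gradient is bounded away from
zero, the boundedness of the gap on the sublevel set of `x0` yields the constant. -/
lemma exists_errorBound_of_sign (hA : A.PosSemidef) (hτ : 0 ≤ τ)
    (hopt : ∃ xs, IsOptimal A b τ xs) (x0 : Fin n → ℝ) (σ : Fin n → SignType) :
    ∃ C : ℝ, 0 ≤ C ∧ ∀ x, (∀ i, SignType.sign (x i) = σ i) →
      objective A b τ x ≤ objective A b τ x0 →
      objective A b τ x - faceMin A b τ x ≤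
        C * ∑ i ∈ (zeros x)ᶜ, minSubgrad A b τ x i ^ 2 := by
  set c : Fin n → ℝ := fun i => τ * (σ i : ℝ) with hc
  set J : Finset (Fin n) := Finset.univ.filter fun i => σ i = 0 with hJ
  have hzero : ∀ x : Fin n → ℝ, (∀ i, SignType.sign (x i) = σ i) → zeros x = J := by
    intro x hx
    ext i
    simp [hJ, zeros, ← hx i, sign_eq_zero_iff]
  have hle : ∀ z, quad A (b - c) z ≤ objective A b τ z := fun z =>
    quad_sub_right_le_objective fun i => mul_le_mul_abs_of_abs_le (by
      rw [hc, abs_mul, abs_of_nonneg hτ]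
      refine mul_le_of_le_one_right hτ ?_
      cases σ i <;> simp) _
  have heq : ∀ x : Fin n → ℝ, (∀ i, SignType.sign (x i) = σ i) →
      quad A (b - c) x = objective A b τ x := fun x hx =>
    quad_sub_right_eq_objective fun i => by
      rw [hc, mul_assoc, ← hx i, sign_mul_self]
  have hgrad : ∀ x : Fin n → ℝ, (∀ i, SignType.sign (x i) = σ i) →
      ∑ i ∈ (zeros x)ᶜ, minSubgrad A b τ x i ^ 2 = ∑ i ∈ Jᶜ, grad A (b - c) x i ^ 2 := by
    intro x hx
    rw [hzero x hx]
    refine Finset.sum_congr rfl fun i hi => ?_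
    have hxi : x i ≠ 0 := fun h => by simp [hJ, ← hx i, h] at hi
    rw [minSubgrad_of_ne hxi]
    have : Real.sign (x i) = (σ i : ℝ) := by
      rw [← hx i]
      rcases lt_or_gt_of_ne hxi with h | h
      · simp [h, Real.sign_of_neg]
      · simp [h, Real.sign_of_pos]
    simp only [this, grad, hc, Pi.sub_apply]
    ring
  rcases quad_sub_le_or_le_sq hA (b - c) J with ⟨C, hC, h⟩ | ⟨m, hm, h⟩
  · refine ⟨C, hC, fun x hx _ => ?_⟩
    rw [hgrad x hx, sub_le_comm]
    refine le_faceMin fun z hz => ?_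
    rw [hzero x hx] at hz
    have h1 := h x (hzero x hx ▸ mem_coordSubspace_zeros x) z hz
    have h2 := heq x hx
    have h3 := hle z
    linarith
  · obtain ⟨xs, hxs⟩ := hopt
    have h0 : 0 ≤ objective A b τ x0 - objective A b τ xs := by linarith [hxs x0]
    refine ⟨(objective A b τ x0 - objective A b τ xs) / m, by positivity, fun x hx hx0 => ?_⟩
    rw [hgrad x hx]
    have h1 := h x (hzero x hx ▸ mem_coordSubspace_zeros x)
    have h2 : objective A b τ xs ≤ faceMin A b τ x := le_faceMin fun z _ => hxs z
    calc _ ≤ objective A b τ x0 - objective A b τ xs := by linarith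
      _ = (objective A b τ x0 - objective A b τ xs) / m * m := by field_simp
      _ ≤ _ := by gcongr

theorem errorBoundConstants_nonempty (hA : A.PosSemidef) (hA0 : A ≠ 0) (hτ : 0 ≤ τ)
    (hopt : ∃ xs, IsOptimal A b τ xs) (x0 : Fin n → ℝ) :
    (errorBoundConstants A b τ x0).Nonempty := by
  choose C hC hCle using exists_errorBound_of_sign (b := b) hA hτ hopt x0
  have hL := specNorm_pos hA0
  refine ⟨2 * specNorm A * ∑ σ, C σ, by
    have := Finset.sum_nonneg fun σ (_ : σ ∈ Finset.univ) => hC σ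
    positivity, fun x hx => ?_⟩
  refine (hCle (fun i => SignType.sign (x i)) x (fun _ => rfl) hx).trans ?_
  rw [subNorm_sq, mul_div_cancel_left₀ _ (by positivity)]
  have := Finset.sum_nonneg fun i (_ : i ∈ (zeros x)ᶜ) => sq_nonneg (minSubgrad A b τ x i)
  gcongr
  exact Finset.single_le_sum (fun σ _ => hC σ) (Finset.mem_univ _)

/-- Each `x` imposes a closed condition on η, so the nonempty set of constants is closed and
contains its infimum. -/
theorem exists_isLeast_errorBoundConstants (hA : A.PosSemidef) (hA0 : A ≠ 0) (hτ : 0 ≤ τ)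
    (hopt : ∃ xs, IsOptimal A b τ xs) (x0 : Fin n → ℝ) :
    ∃ ηs, IsLeast (errorBoundConstants A b τ x0) ηs := by
  have hbdd : BddBelow (errorBoundConstants A b τ x0) := ⟨0, fun _ h => h.1⟩
  have hclosed : IsClosed (errorBoundConstants A b τ x0) := by
    have : errorBoundConstants A b τ x0 = {η | 0 ≤ η} ∩
        ⋂ x, ⋂ (_ : objective A b τ x ≤ objective A b τ x0),
          {η | objective A b τ x - faceMin A b τ x ≤
            η / (2 * specNorm A) * subNorm (zeros x)ᶜ (minSubgrad A b τ x) ^ 2} := by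
      ext η
      simp [errorBoundConstants]
    rw [this]
    exact (isClosed_le continuous_const continuous_id).inter
      (isClosed_iInter fun x => isClosed_iInter fun _ =>
        isClosed_le continuous_const (by fun_prop))
  exact ⟨_, hclosed.csInf_mem (errorBoundConstants_nonempty hA hA0 hτ hopt x0) hbdd,
    fun _ h => csInf_le hbdd h⟩

/-! ### Conjugate gradients -/

/-- The invariant of the conjugate gradient loop for `quad A b` on `coordSubspace J0`, where `W` is
the span of the previous residuals. -/
structure CGInv (A : Matrix (Fin n) (Fin n) ℝ) (b : Fin n → ℝ) (J0 : Finset (Fin n))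
    (s : CGState n) (W : Submodule ℝ (Fin n → ℝ)) : Prop where
  r_eq : s.r = grad A b s.x
  p_eq : s.p = coordProj J0 s.r
  d_mem : s.d ∈ coordSubspace J0
  mem_of_mem : ∀ w ∈ W, w ∈ coordSubspace J0
  p_orth : ∀ w ∈ W, s.p ⬝ᵥ w = 0
  d_conj : ∀ w ∈ W, s.d ⬝ᵥ A *ᵥ w = 0
  d_add_p_mem : s.d + s.p ∈ W
  -- This makes the next residual automatically conjugate to `W`, so the recurrence need only
  -- correct against the last direction.
  krylov : ∀ w ∈ W, coordProj J0 (A *ᵥ w) ∈ W ⊔ ℝ ∙ s.p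

lemma neg_mem_coordSubspace {J : Finset (Fin n)} {u : Fin n → ℝ} (h : u ∈ coordSubspace J) :
    -u ∈ coordSubspace J := fun i hi => by simp [h i hi]

lemma add_mem_coordSubspace {J : Finset (Fin n)} {u w : Fin n → ℝ} (hu : u ∈ coordSubspace J)
    (hw : w ∈ coordSubspace J) : u + w ∈ coordSubspace J := fun i hi => by simp [hu i hi, hw i hi]

lemma smul_mem_coordSubspace {J : Finset (Fin n)} {u : Fin n → ℝ} (a : ℝ)
    (h : u ∈ coordSubspace J) : a • u ∈ coordSubspace J := fun i hi => by simp [h i hi]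

lemma cgInv_init (A : Matrix (Fin n) (Fin n) ℝ) (b c : Fin n → ℝ) (J0 : Finset (Fin n))
    (x0 : Fin n → ℝ) : CGInv A (b - c) J0 (cgInit A b c J0 x0) ⊥ where
  r_eq := by simp only [cgInit, grad]; abel
  p_eq := rfl
  d_mem := neg_mem_coordSubspace (coordProj_mem _ _)
  mem_of_mem := by
    intro w hw i _
    simp [(Submodule.mem_bot ℝ).1 hw]
  p_orth := by
    intro w hw
    simp [(Submodule.mem_bot ℝ).1 hw]
  d_conj := by
    intro w hw
    simp [(Submodule.mem_bot ℝ).1 hw]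
  d_add_p_mem := by simp [cgInit]
  krylov := by
    intro w hw
    rw [(Submodule.mem_bot ℝ).1 hw, Matrix.mulVec_zero, ← zero_smul ℝ (0 : Fin n → ℝ),
      coordProj_smul, zero_smul]
    exact zero_mem _

section

variable {J0 Jm Jp : Finset (Fin n)} {s : CGState n} {W : Submodule ℝ (Fin n → ℝ)}

lemma CGInv.p_dot_d (h : CGInv A b J0 s W) : s.p ⬝ᵥ s.d = -(s.p ⬝ᵥ s.p) := by
  have := h.p_orth _ h.d_add_p_mem
  rw [dotProduct_add] at this
  linarith

lemma CGInv.quad_step (hA : A.PosSemidef) (h : CGInv A b J0 s W) (α : ℝ) :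
    quad A b (s.x + α • s.d) =
      quad A b s.x - α * (s.p ⬝ᵥ s.p) + α ^ 2 / 2 * (s.d ⬝ᵥ A *ᵥ s.d) := by
  have h1 : grad A b s.x ⬝ᵥ s.d = -(s.p ⬝ᵥ s.p) := by
    rw [← h.p_dot_d, ← h.r_eq, h.p_eq, coordProj_dotProduct _ h.d_mem]
  rw [quad_add hA]
  simp only [Matrix.mulVec_smul, smul_dotProduct, dotProduct_smul, smul_eq_mul, h1]
  ring

/-- Since `d` is `-p` modulo `W`, adjoining `p` to `W` is the same as adjoining `d`. -/
lemma CGInv.exists_eq_add_smul (h : CGInv A b J0 s W) {w : Fin n → ℝ} (hw : w ∈ W ⊔ ℝ ∙ s.p) :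
    ∃ y ∈ W, ∃ a : ℝ, w = y + a • s.d := by
  obtain ⟨y, hy, z, hz, rfl⟩ := Submodule.mem_sup.1 hw
  obtain ⟨a, rfl⟩ := Submodule.mem_span_singleton.1 hz
  refine ⟨y + a • (s.d + s.p), W.add_mem hy (W.smul_mem _ h.d_add_p_mem), -a, ?_⟩
  rw [smul_add, neg_smul]
  abel

lemma CGInv.d_mem_sup (h : CGInv A b J0 s W) : s.d ∈ W ⊔ ℝ ∙ s.p := by
  have h1 : s.d = (s.d + s.p) - s.p := by abel
  rw [h1]
  exact sub_mem (Submodule.mem_sup_left h.d_add_p_mem)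
    (Submodule.mem_sup_right (Submodule.mem_span_singleton_self _))

/-- The step length makes the new residual orthogonal to `d`, and the recurrence coefficient makes
the new direction conjugate to `d`. Against `W`, orthogonality follows from the old invariant and
conjugacy from the `krylov` field. -/
theorem CGInv.next (hA : A.PosSemidef) (h : CGInv A b J0 s W) (hp : s.p ≠ 0)
    (hd : s.d ⬝ᵥ A *ᵥ s.d ≠ 0) :
    CGInv A b J0 (cgNext A J0 s ((s.p ⬝ᵥ s.p) / (s.d ⬝ᵥ A *ᵥ s.d))) (W ⊔ ℝ ∙ s.p) := by
  have hpp : s.p ⬝ᵥ s.p ≠ 0 := fun h0 => hp (dotProduct_self_eq_zero.1 h0)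
  set α := (s.p ⬝ᵥ s.p) / (s.d ⬝ᵥ A *ᵥ s.d) with hα
  have hα0 : α ≠ 0 := div_ne_zero hpp hd
  have hαd : α * (s.d ⬝ᵥ A *ᵥ s.d) = s.p ⬝ᵥ s.p := div_mul_cancel₀ _ hd
  set p' := coordProj J0 (s.r + α • (A *ᵥ s.d)) with hp'
  have hp'eq : p' = s.p + α • coordProj J0 (A *ᵥ s.d) := by
    rw [hp', coordProj_add, coordProj_smul, ← h.p_eq]
  have hp'mem : p' ∈ coordSubspace J0 := coordProj_mem _ _
  have hsmem : s.p ∈ W ⊔ ℝ ∙ s.p := Submodule.mem_sup_right (Submodule.mem_span_singleton_self _)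
  have horth : ∀ w ∈ W ⊔ ℝ ∙ s.p, p' ⬝ᵥ w = 0 := by
    intro w hw
    obtain ⟨y, hy, a, rfl⟩ := h.exists_eq_add_smul hw
    have h1 : p' ⬝ᵥ y = 0 := by
      rw [hp'eq, add_dotProduct, smul_dotProduct, coordProj_dotProduct _ (h.mem_of_mem y hy),
        dotProduct_comm (A *ᵥ s.d), form_comm hA, h.p_orth y hy, h.d_conj y hy]
      simp
    have h2 : p' ⬝ᵥ s.d = 0 := by
      rw [hp'eq, add_dotProduct, smul_dotProduct, coordProj_dotProduct _ h.d_mem,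
        dotProduct_comm (A *ᵥ s.d), h.p_dot_d, smul_eq_mul, hαd]
      ring
    rw [dotProduct_add, dotProduct_smul, h1, h2]
    simp
  have hp'A : ∀ w, p' ⬝ᵥ A *ᵥ w = p' ⬝ᵥ coordProj J0 (A *ᵥ w) := fun w =>
    (dotProduct_coordProj _ hp'mem).symm
  have hPAd : coordProj J0 (A *ᵥ s.d) = α⁻¹ • (p' - s.p) := by
    rw [hp'eq, add_sub_cancel_left, smul_smul, inv_mul_cancel₀ hα0, one_smul]
  refine ⟨?_, rfl, ?_, ?_, horth, ?_, ?_, ?_⟩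
  · simp only [cgNext]
    rw [grad_add, Matrix.mulVec_smul, h.r_eq]
  · exact add_mem_coordSubspace (neg_mem_coordSubspace hp'mem) (smul_mem_coordSubspace _ h.d_mem)
  · intro w hw
    obtain ⟨y, hy, a, rfl⟩ := h.exists_eq_add_smul hw
    exact add_mem_coordSubspace (h.mem_of_mem y hy) (smul_mem_coordSubspace _ h.d_mem)
  · intro w hw
    obtain ⟨y, hy, a, rfl⟩ := h.exists_eq_add_smul hw
    change (-p' + ((p' ⬝ᵥ p') / (s.p ⬝ᵥ s.p)) • s.d) ⬝ᵥ _ = 0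
    have h1 : p' ⬝ᵥ A *ᵥ y = 0 := by rw [hp'A, horth _ (h.krylov y hy)]
    have h2 : p' ⬝ᵥ A *ᵥ s.d = (p' ⬝ᵥ p') / (s.p ⬝ᵥ s.p) * (s.d ⬝ᵥ A *ᵥ s.d) := by
      rw [hp'A, hPAd, dotProduct_smul, dotProduct_sub, horth _ hsmem, hα, smul_eq_mul]
      field_simp
      ring
    simp only [Matrix.mulVec_add, Matrix.mulVec_smul, add_dotProduct, neg_dotProduct,
      dotProduct_add, dotProduct_smul, smul_dotProduct, smul_eq_mul, h1, h2, h.d_conj y hy]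
    ring
  · change -p' + ((p' ⬝ᵥ p') / (s.p ⬝ᵥ s.p)) • s.d + p' ∈ _
    rw [neg_add_cancel_comm]
    exact Submodule.smul_mem _ _ h.d_mem_sup
  · intro w hw
    change _ ∈ _ ⊔ ℝ ∙ p'
    obtain ⟨y, hy, a, rfl⟩ := h.exists_eq_add_smul hw
    rw [Matrix.mulVec_add, Matrix.mulVec_smul, coordProj_add, coordProj_smul, hPAd]
    exact add_mem (Submodule.mem_sup_left (h.krylov y hy))
      (Submodule.smul_mem _ _ (Submodule.smul_mem _ _ (sub_mem
        (Submodule.mem_sup_right (Submodule.mem_span_singleton_self _))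
        (Submodule.mem_sup_left hsmem))))

/-- A nonzero residual orthogonal to `W` lies outside `W`. This strict growth of dimension bounds
the length of the loop. -/
lemma CGInv.finrank_lt (h : CGInv A b J0 s W) (hp : s.p ≠ 0) :
    Module.finrank ℝ W < Module.finrank ℝ (W ⊔ ℝ ∙ s.p : Submodule ℝ (Fin n → ℝ)) := by
  refine Submodule.finrank_lt_finrank_of_lt (lt_of_le_of_ne le_sup_left fun heq => hp ?_)
  have : s.p ∈ W := by
    rw [heq]
    exact Submodule.mem_sup_right (Submodule.mem_span_singleton_self _)
  exact dotProduct_self_eq_zero.1 (h.p_orth _ this)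

/-! ### The step length -/

lemma tcLength_nonneg (hx : s.x ∈ feasible J0 Jm Jp) : 0 ≤ tcLength J0 Jm Jp s :=
  le_sSup ⟨0, by simpa using hx, rfl⟩

lemma cgLength_nonneg (hA : A.PosSemidef) (s : CGState n) : 0 ≤ cgLength A s := by
  unfold cgLength
  split_ifs
  · exact le_top
  · exact_mod_cast div_nonneg (dotProduct_self_nonneg _) (form_nonneg hA _)

lemma IsStepLength.nonneg (hA : A.PosSemidef) (hx : s.x ∈ feasible J0 Jm Jp) {α : ℝ}
    (hα : IsStepLength A J0 Jm Jp s α) : 0 ≤ α := by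
  have : (0 : EReal) ≤ α := hα.2 ▸ le_min (cgLength_nonneg hA s) (tcLength_nonneg hx)
  exact_mod_cast this

/-- The supremum defining the truncation length is attained: a coordinate of the wrong sign at α
would cap all feasible lengths by `-x j / d j`, below α. -/
lemma add_smul_mem_feasible (hx : s.x ∈ feasible J0 Jm Jp) (hd : s.d ∈ coordSubspace J0) {α : ℝ}
    (hα0 : 0 ≤ α) (hα : (α : EReal) ≤ tcLength J0 Jm Jp s) :
    s.x + α • s.d ∈ feasible J0 Jm Jp := by
  refine ⟨fun j hj => by simp [hx.1 j hj, hd j hj], fun j hj => ?_, fun j hj => ?_⟩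
  · by_contra! hlt
    have hxj := hx.2.1 j hj
    simp only [Pi.add_apply, Pi.smul_apply, smul_eq_mul] at hlt
    have hdj : 0 < s.d j := by
      by_contra! h
      nlinarith
    have h1 : tcLength J0 Jm Jp s ≤ ((-s.x j / s.d j : ℝ) : EReal) := by
      refine sSup_le ?_
      rintro _ ⟨γ, hγ, rfl⟩
      have := hγ.2.1 j hj
      simp only [Pi.add_apply, Pi.smul_apply, smul_eq_mul] at this
      exact EReal.coe_le_coe_iff.2 ((le_div_iff₀ hdj).2 (by linarith))
    have h2 := (le_div_iff₀ hdj).1 (EReal.coe_le_coe_iff.1 (hα.trans h1))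
    linarith
  · by_contra! hlt
    have hxj := hx.2.2 j hj
    simp only [Pi.add_apply, Pi.smul_apply, smul_eq_mul] at hlt
    have hdj : s.d j < 0 := by
      by_contra! h
      nlinarith [mul_nonneg hα0 h]
    have h1 : tcLength J0 Jm Jp s ≤ ((-s.x j / s.d j : ℝ) : EReal) := by
      refine sSup_le ?_
      rintro _ ⟨γ, hγ, rfl⟩
      have := hγ.2.2 j hj
      simp only [Pi.add_apply, Pi.smul_apply, smul_eq_mul] at this
      exact EReal.coe_le_coe_iff.2 ((le_div_iff_of_neg hdj).2 (by linarith))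
    have h2 := (le_div_iff_of_neg hdj).1 (EReal.coe_le_coe_iff.1 (hα.trans h1))
    linarith

/-- If all sign constraints were strict at α, continuity would allow a slightly longer feasible
step. -/
lemma exists_eq_zero_of_eq_tcLength (hd : s.d ∈ coordSubspace J0) {α : ℝ}
    (hα : (α : EReal) = tcLength J0 Jm Jp s) (hmem : s.x + α • s.d ∈ feasible J0 Jm Jp) :
    ∃ i ∈ Jm ∪ Jp, (s.x + α • s.d) i = 0 := by
  by_contra! hne
  have hcont : ∀ i, Continuous fun β : ℝ => (s.x + β • s.d) i := fun i => by
    simp only [Pi.add_apply, Pi.smul_apply, smul_eq_mul]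
    fun_prop
  have hm : ∀ᶠ β in nhds α, ∀ j ∈ Jm, (s.x + β • s.d) j < 0 :=
    (Filter.eventually_all_finset Jm).2 fun j hj =>
      (hcont j).continuousAt.eventually_lt_const
        ((hmem.2.1 j hj).lt_of_ne (hne j (Finset.mem_union_left _ hj)))
  have hp : ∀ᶠ β in nhds α, ∀ j ∈ Jp, 0 < (s.x + β • s.d) j :=
    (Filter.eventually_all_finset Jp).2 fun j hj =>
      (hcont j).continuousAt.eventually_const_lt
        ((hmem.2.2 j hj).lt_of_ne (hne j (Finset.mem_union_right _ hj)).symm)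
  obtain ⟨β, ⟨h1, h2⟩, hβ⟩ := (((hm.and hp).filter_mono nhdsWithin_le_nhds).and
    (self_mem_nhdsWithin : Set.Ioi α ∈ nhdsWithin α (Set.Ioi α))).exists
  have h3 : (β : EReal) ≤ α := hα ▸ le_sSup ⟨β, ⟨fun j hj => by
    have := hmem.1 j hj
    simp only [Pi.add_apply, Pi.smul_apply, smul_eq_mul, hd j hj, mul_zero] at this ⊢
    exact this, fun j hj => (h1 j hj).le, fun j hj => (h2 j hj).le⟩, rfl⟩
  exact absurd (EReal.coe_le_coe_iff.1 h3) (not_le.2 hβ)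

lemma IsStepLength.eq_of_not_lt {α : ℝ} (hα : IsStepLength A J0 Jm Jp s α)
    (hge : ¬ (α : EReal) < cgLength A s) :
    s.d ⬝ᵥ A *ᵥ s.d ≠ 0 ∧ α = (s.p ⬝ᵥ s.p) / (s.d ⬝ᵥ A *ᵥ s.d) := by
  have h1 : (α : EReal) = cgLength A s :=
    le_antisymm (hα.2 ▸ min_le_left _ _) (not_lt.1 hge)
  unfold cgLength at h1
  split_ifs at h1 with h
  · exact absurd h1 (EReal.coe_ne_top α)
  · exact ⟨h, EReal.coe_injective h1⟩

lemma CGInv.exists_isStepLength (hA : A.PosSemidef) (h : CGInv A b J0 s W) (hp : s.p ≠ 0)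
    (hx : s.x ∈ feasible J0 Jm Jp) {m : ℝ} (hm : ∀ z ∈ feasible J0 Jm Jp, m ≤ quad A b z) :
    ∃ α, IsStepLength A J0 Jm Jp s α := by
  have hpp : 0 < s.p ⬝ᵥ s.p :=
    (dotProduct_self_nonneg _).lt_of_ne fun h0 => hp (dotProduct_self_eq_zero.1 h0.symm)
  have hbot : min (cgLength A s) (tcLength J0 Jm Jp s) ≠ ⊥ :=
    ne_of_gt (EReal.bot_lt_zero.trans_le (le_min (cgLength_nonneg hA s) (tcLength_nonneg hx)))
  have htop : min (cgLength A s) (tcLength J0 Jm Jp s) ≠ ⊤ := by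
    intro htop
    rw [min_eq_top] at htop
    obtain ⟨h1, h2⟩ := htop
    have hd : s.d ⬝ᵥ A *ᵥ s.d = 0 := by
      by_contra hd
      rw [cgLength, if_neg hd] at h1
      exact EReal.coe_ne_top _ h1
    -- If both lengths are infinite the model is linear along `d`; any feasible step beyond this
    -- threshold takes it below its lower bound `m`.
    have h3 : (((quad A b s.x - m) / (s.p ⬝ᵥ s.p) : ℝ) : EReal) < tcLength J0 Jm Jp s :=
      h2 ▸ EReal.coe_lt_top _
    obtain ⟨_, ⟨γ, hγ, rfl⟩, hlt⟩ := lt_sSup_iff.1 h3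
    have h4 := (div_lt_iff₀ hpp).1 (EReal.coe_lt_coe_iff.1 hlt)
    have h5 := hm _ hγ
    rw [h.quad_step hA, hd] at h5
    linarith
  exact ⟨_, hp, EReal.coe_toReal htop hbot⟩

/-! ### The subroutine TPCG1 -/

/-- The model decreases up to the CG length, and the truncation length preserves feasibility. An
exit short of the CG length means truncation, hence a coordinate of `Jm ∪ Jp` becomes zero; the
other exit is the residual test. -/
theorem CGReturns.spec (hA : A.PosSemidef) {δ : ℝ} {y : Fin n → ℝ}
    (hy : CGReturns A J0 Jm Jp δ s y) (h : CGInv A b J0 s W) (hx : s.x ∈ feasible J0 Jm Jp) :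
    y ∈ feasible J0 Jm Jp ∧ quad A b y ≤ quad A b s.x ∧
      ((∃ i ∈ Jm ∪ Jp, y i = 0) ∨ ‖coordProj J0 (grad A b y)‖ ≤ δ) := by
  have key : ∀ {s : CGState n} {W : Submodule ℝ (Fin n → ℝ)} {α : ℝ}, CGInv A b J0 s W →
      s.x ∈ feasible J0 Jm Jp → IsStepLength A J0 Jm Jp s α →
      s.x + α • s.d ∈ feasible J0 Jm Jp ∧ quad A b (s.x + α • s.d) ≤ quad A b s.x := by
    intro s W α h hx hα
    have hα0 := hα.nonneg hA hx
    refine ⟨add_smul_mem_feasible hx h.d_mem hα0 (hα.2 ▸ min_le_right _ _), ?_⟩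
    have hpp := dotProduct_self_nonneg s.p
    rw [h.quad_step hA]
    have h1 : (α : EReal) ≤ cgLength A s := hα.2 ▸ min_le_left _ _
    unfold cgLength at h1
    split_ifs at h1 with hd
    · rw [hd]
      nlinarith
    · have hd' := (form_nonneg hA s.d).lt_of_ne (Ne.symm hd)
      have h2 := (le_div_iff₀ hd').1 (EReal.coe_le_coe_iff.1 h1)
      nlinarith [mul_le_mul_of_nonneg_left h2 hα0, mul_nonneg hα0 hpp]
  induction hy generalizing W with
  | boundary s α hα hlt =>
    obtain ⟨h1, h2⟩ := key h hx hα
    refine ⟨h1, h2, Or.inl (exists_eq_zero_of_eq_tcLength h.d_mem ?_ h1)⟩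
    rcases min_choice (cgLength A s) (tcLength J0 Jm Jp s) with h3 | h3
    · exact absurd (hα.2.trans h3) hlt.ne
    · exact hα.2.trans h3
  | converged s α hα hge htol =>
    obtain ⟨h1, h2⟩ := key h hx hα
    refine ⟨h1, h2, Or.inr ?_⟩
    have h3 : grad A b (s.x + α • s.d) = s.r + α • (A *ᵥ s.d) := by
      rw [grad_add, Matrix.mulVec_smul, h.r_eq]
    rw [h3]
    exact htol
  | advance s α y hα hge htol hrest ih =>
    obtain ⟨h1, h2⟩ := key h hx hα
    obtain ⟨hd, rfl⟩ := hα.eq_of_not_lt hge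
    obtain ⟨h3, h4, h5⟩ := ih (h.next hA hα.1 hd) h1
    exact ⟨h3, h4.trans h2, h5⟩

/-- Finite termination of the conjugate gradient loop: the residuals are orthogonal. -/
theorem CGInv.exists_cgReturns (hA : A.PosSemidef) {δ : ℝ} (hδ : 0 ≤ δ) {m : ℝ}
    (hm : ∀ z ∈ feasible J0 Jm Jp, m ≤ quad A b z) (h : CGInv A b J0 s W) (hp : s.p ≠ 0)
    (hx : s.x ∈ feasible J0 Jm Jp) : ∃ y, CGReturns A J0 Jm Jp δ s y := by
  -- The codimension of the span of the residuals decreases with every pass.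
  induction hk : n - Module.finrank ℝ W using Nat.strong_induction_on generalizing s W with
  | _ k ih =>
    obtain ⟨α, hα⟩ := h.exists_isStepLength hA hp hx hm
    by_cases hlt : (α : EReal) < cgLength A s
    · exact ⟨_, .boundary s α hα hlt⟩
    by_cases htol : ‖(cgNext A J0 s α).p‖ ≤ δ
    · exact ⟨_, .converged s α hα hlt htol⟩
    have hx' : (cgNext A J0 s α).x ∈ feasible J0 Jm Jp :=
      add_smul_mem_feasible hx h.d_mem (hα.nonneg hA hx) (hα.2 ▸ min_le_right _ _)
    have hinv : CGInv A b J0 (cgNext A J0 s α) (W ⊔ ℝ ∙ s.p) := by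
      obtain ⟨hd, rfl⟩ := hα.eq_of_not_lt hlt
      exact h.next hA hp hd
    have hlt' := h.finrank_lt hp
    have hle := Submodule.finrank_le (W ⊔ ℝ ∙ s.p : Submodule ℝ (Fin n → ℝ))
    rw [Module.finrank_fin_fun] at hle
    obtain ⟨y, hy⟩ := ih _ (by omega) hinv
      (fun h0 => htol (by rw [h0, norm_zero]; exact hδ)) hx' rfl
    exact ⟨y, .advance s α y hα hlt htol hy⟩

lemma IsStepLength.unique {α β : ℝ} (hα : IsStepLength A J0 Jm Jp s α)
    (hβ : IsStepLength A J0 Jm Jp s β) : α = β :=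
  EReal.coe_injective (hα.2.trans hβ.2.symm)

theorem CGReturns.unique {δ : ℝ} {y z : Fin n → ℝ} (hy : CGReturns A J0 Jm Jp δ s y)
    (hz : CGReturns A J0 Jm Jp δ s z) : y = z := by
  induction hy with
  | boundary s α hα hlt =>
    cases hz with
    | boundary _ β hβ _ => rw [hα.unique hβ]
    | converged _ β hβ hge _ => exact absurd (hα.unique hβ ▸ hlt) hge
    | advance _ β _ hβ hge _ _ => exact absurd (hα.unique hβ ▸ hlt) hge
  | converged s α hα hge htol =>
    cases hz with
    | boundary _ β hβ hlt => exact absurd (hβ.unique hα ▸ hlt) hge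
    | converged _ β hβ _ _ => rw [hα.unique hβ]
    | advance _ β _ hβ _ htol' _ => exact absurd (hα.unique hβ ▸ htol) htol'
  | advance s α y hα hge htol hrest ih =>
    cases hz with
    | boundary _ β hβ hlt => exact absurd (hβ.unique hα ▸ hlt) hge
    | converged _ β hβ _ htol' => exact absurd (hβ.unique hα ▸ htol') htol
    | advance _ β _ hβ _ _ hrest' => exact ih (hβ.unique hα ▸ hrest')

end

end GCG

namespace GCG

variable {n : ℕ} {A : Matrix (Fin n) (Fin n) ℝ} {b : Fin n → ℝ} {τ : ℝ}

/-! ### The proximal gradient step -/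

/-- Soft thresholding. -/
lemma exists_eq_sub_of_abs_le (u : ℝ) {c : ℝ} (hc : 0 ≤ c) :
    ∃ x w : ℝ, |w| ≤ c ∧ w * x = c * |x| ∧ x = u - w := by
  rcases lt_or_ge c u with h | h
  · exact ⟨u - c, c, (abs_of_nonneg hc).le, by rw [abs_of_pos (by linarith)], rfl⟩
  rcases lt_or_ge u (-c) with h' | h'
  · exact ⟨u + c, -c, by rw [abs_neg, abs_of_nonneg hc], by rw [abs_of_neg (by linarith)]; ring,
      by ring⟩
  · exact ⟨0, u, abs_le.2 ⟨h', h⟩, by simp, by ring⟩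

/-- `x'` is the result of the proximal gradient step from `y` on `coordSubspace (zeros y)`, with
`ω` the subgradient of `τ‖·‖₁` at `x'` from the optimality condition. -/
structure IsProxStep (A : Matrix (Fin n) (Fin n) ℝ) (b : Fin n → ℝ) (τ t : ℝ)
    (y x' ω : Fin n → ℝ) : Prop where
  abs_le : ∀ i, |ω i| ≤ τ
  mul_eq : ∀ i, ω i * x' i = τ * |x' i|
  mem : x' ∈ coordSubspace (zeros y)
  eq : ∀ i, y i ≠ 0 → x' i = y i - t * (grad A b y i + ω i)

lemma exists_isProxStep (A : Matrix (Fin n) (Fin n) ℝ) (b : Fin n → ℝ) {t : ℝ} (hτ : 0 ≤ τ)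
    (ht : 0 < t) (y : Fin n → ℝ) : ∃ x' ω, IsProxStep A b τ t y x' ω := by
  choose x w h1 h2 h3 using fun i : Fin n =>
    exists_eq_sub_of_abs_le (y i - t * grad A b y i) (mul_nonneg ht.le hτ)
  refine ⟨fun i => if y i = 0 then 0 else x i, fun i => if y i = 0 then 0 else w i / t,
    fun i => ?_, fun i => ?_, fun i hi => ?_, fun i hi => ?_⟩
  · split_ifs
    · simpa using hτ
    · rw [abs_div, abs_of_pos ht, div_le_iff₀ ht, mul_comm]
      exact h1 i
  · split_ifs
    · simp
    · rw [div_mul_eq_mul_div, h2]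
      field_simp
  · simp [mem_zeros.1 hi]
  · simp only [hi, if_false]
    rw [h3]
    field_simp
    ring

variable {t : ℝ} {y x' ω : Fin n → ℝ}

/-- Strong convexity with the subgradient ω as certificate; minimality and uniqueness both follow.
-/
lemma IsProxStep.proxObjective_add_le (h : IsProxStep A b τ t y x' ω) (ht : 0 < t)
    {z : Fin n → ℝ} (hz : z ∈ coordSubspace (zeros y)) :
    proxObjective A b τ t y x' + 1 / 2 * ∑ i, (z i - x' i) ^ 2 ≤ proxObjective A b τ t y z := by
  simp only [proxObjective, Finset.mul_sum, ← Finset.sum_add_distrib]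
  refine Finset.sum_le_sum fun i _ => ?_
  by_cases hi : y i = 0
  · rw [hz i (mem_zeros.2 hi), h.mem i (mem_zeros.2 hi)]
    simp
  · have h1 := mul_le_mul_abs_of_abs_le (h.abs_le i) (z i)
    have h2 := h.mul_eq i
    have h3 := h.eq i hi
    have h4 : x' i - (y i - t * grad A b y i) = -(t * ω i) := by rw [h3]; ring
    have h5 : (1 / 2) * (x' i - (y i - t * grad A b y i)) ^ 2 + 1 / 2 * (z i - x' i) ^ 2 =
        (1 / 2) * (z i - (y i - t * grad A b y i)) ^ 2 + (z i - x' i) * (t * ω i) := by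
      linear_combination (-(z i - x' i)) * h4
    have h6 := mul_le_mul_of_nonneg_left h1 ht.le
    linear_combination h5 + h6 - t * h2

lemma IsProxStep.isMin (h : IsProxStep A b τ t y x' ω) (ht : 0 < t) :
    ∀ z ∈ coordSubspace (zeros y), proxObjective A b τ t y x' ≤ proxObjective A b τ t y z := by
  intro z hz
  have h1 := h.proxObjective_add_le ht hz
  have := Finset.sum_nonneg fun i (_ : i ∈ Finset.univ) => sq_nonneg (z i - x' i)
  linarith

lemma IsProxStep.eq_of_isMin (h : IsProxStep A b τ t y x' ω) (ht : 0 < t) {u : Fin n → ℝ}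
    (hu : u ∈ coordSubspace (zeros y))
    (hmin : ∀ z ∈ coordSubspace (zeros y),
      proxObjective A b τ t y u ≤ proxObjective A b τ t y z) : u = x' := by
  have h1 := h.proxObjective_add_le ht hu
  have h2 := hmin x' h.mem
  have h3 : ∀ i ∈ Finset.univ, 0 ≤ (u i - x' i) ^ 2 := fun i _ => sq_nonneg _
  have h4 : ∑ i, (u i - x' i) ^ 2 = 0 := le_antisymm (by linarith) (Finset.sum_nonneg h3)
  ext i
  have := (Finset.sum_eq_zero_iff_of_nonneg h3).1 h4 i (Finset.mem_univ i)
  exact sub_eq_zero.1 (pow_eq_zero_iff (two_ne_zero)|>.1 this)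

/-- The quadratic tilted by ω equals `F` at `x'` and lies below `F` at `y`, and its gradient at `y`
is `-t⁻¹(x' - y)` on the free coordinates. The coefficient is positive exactly for `t < 2/‖A‖`. -/
lemma IsProxStep.objective_add_le (hA : A.PosSemidef) (h : IsProxStep A b τ t y x' ω)
    (ht : 0 < t) :
    objective A b τ x' + (t⁻¹ - specNorm A / 2) * ((x' - y) ⬝ᵥ (x' - y)) ≤
      objective A b τ y := by
  have h1 : quad A (b - ω) x' = objective A b τ x' := quad_sub_right_eq_objective h.mul_eq
  have h2 : quad A (b - ω) y ≤ objective A b τ y :=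
    quad_sub_right_le_objective fun i => mul_le_mul_abs_of_abs_le (h.abs_le i) _
  have h3 := quad_add hA (b - ω) y (x' - y)
  rw [add_sub_cancel, h1] at h3
  have h4 : grad A (b - ω) y ⬝ᵥ (x' - y) = -t⁻¹ * ((x' - y) ⬝ᵥ (x' - y)) := by
    simp only [dotProduct, Finset.mul_sum]
    refine Finset.sum_congr rfl fun i _ => ?_
    by_cases hi : y i = 0
    · simp [hi, h.mem i (mem_zeros.2 hi)]
    · have h5 : x' i - y i = -t * (grad A b y i + ω i) := by rw [h.eq i hi]; ring
      have h6 : grad A (b - ω) y i = -t⁻¹ * (x' i - y i) := by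
        rw [h5]
        simp only [grad, Pi.sub_apply]
        field_simp
        ring
      rw [h6]
      simp only [Pi.sub_apply]
      ring
  have h5 := form_le A (x' - y)
  rw [h4] at h3
  linarith

/-- Monotonicity of the subdifferential of `τ|·|`, applied to `v - ∇f` at `y` and ω at `x'`, gives
`|x' i - y i| ≤ t |v i|` on the free coordinates. -/
lemma IsProxStep.sq_sub_le (hτ : 0 ≤ τ) (h : IsProxStep A b τ t y x' ω) (ht : 0 < t) :
    (x' - y) ⬝ᵥ (x' - y) ≤ t ^ 2 * subNorm (zeros y)ᶜ (minSubgrad A b τ y) ^ 2 := by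
  rw [subNorm_sq, ← coordProj_sq, dotProduct, dotProduct, Finset.mul_sum]
  refine Finset.sum_le_sum fun i _ => ?_
  by_cases hi : y i = 0
  · simp [hi, h.mem i (mem_zeros.2 hi), coordProj, mem_zeros]
  · simp only [coordProj, mem_zeros, hi, if_false, Pi.sub_apply]
    set v := minSubgrad A b τ y i
    set g := grad A b y i
    have h1 : x' i - y i = -t * (g + ω i) := by rw [h.eq i hi]; ring
    have h2 : (v - g) * y i = τ * |y i| := minSubgrad_sub_grad_mul y i
    have h3 : (v - g) * x' i ≤ τ * |x' i| :=
      mul_le_mul_abs_of_abs_le (abs_minSubgrad_sub_grad_le hτ y i) _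
    have h4 := h.mul_eq i
    have h5 := mul_le_mul_abs_of_abs_le (h.abs_le i) (y i)
    have h6 : (x' i - y i) * (x' i - y i) ≤ -t * v * (x' i - y i) := by
      have h7 : 0 ≤ (ω i - (v - g)) * (x' i - y i) := by linarith
      linear_combination (x' i - y i) * h1 + mul_nonneg ht.le h7
    nlinarith [sq_nonneg (t * v + (x' i - y i))]

/-- Where `x'` is nonzero ω is forced, so `v(x')` is there `(A - t⁻¹)(x' - y)`. The terms in `A` of
its squared norm sum to something nonpositive by `mulVec_sq_le` and `‖A‖ ≤ 2/t`. -/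
lemma IsProxStep.sq_minSubgrad_le (hA : A.PosSemidef) (h : IsProxStep A b τ t y x' ω)
    (ht : 0 < t) (htL : specNorm A ≤ 2 * t⁻¹) (hz : zeros x' = zeros y) :
    subNorm (zeros x')ᶜ (minSubgrad A b τ x') ^ 2 ≤ (t⁻¹) ^ 2 * ((x' - y) ⬝ᵥ (x' - y)) := by
  have h1 : ∀ i ∈ (zeros x')ᶜ, minSubgrad A b τ x' i = (A *ᵥ (x' - y) - t⁻¹ • (x' - y)) i := by
    intro i hi
    rw [Finset.mem_compl] at hi
    have hxi : x' i ≠ 0 := fun h0 => hi (mem_zeros.2 h0)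
    have hyi : y i ≠ 0 := fun h0 => hi (hz ▸ mem_zeros.2 h0)
    have h2 : (minSubgrad A b τ x' i - grad A b x' i) = ω i :=
      mul_right_cancel₀ hxi ((minSubgrad_sub_grad_mul x' i).trans (h.mul_eq i).symm)
    have h3 : grad A b x' i = grad A b y i + (A *ᵥ (x' - y)) i := by
      rw [← Pi.add_apply, ← grad_add, add_sub_cancel]
    have h4 : x' i - y i = -t * (grad A b y i + ω i) := by rw [h.eq i hyi]; ring
    simp only [Pi.sub_apply, Pi.smul_apply, smul_eq_mul, h4]
    have h5 : t⁻¹ * (-t * (grad A b y i + ω i)) = -(grad A b y i + ω i) := by field_simp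
    rw [h5]
    linarith
  rw [subNorm_sq, Finset.sum_congr rfl fun i hi => by rw [h1 i hi]]
  calc _ ≤ ∑ i, (A *ᵥ (x' - y) - t⁻¹ • (x' - y)) i ^ 2 :=
        Finset.sum_le_univ_sum_of_nonneg fun i => sq_nonneg _
    _ = (A *ᵥ (x' - y) - t⁻¹ • (x' - y)) ⬝ᵥ (A *ᵥ (x' - y) - t⁻¹ • (x' - y)) := by
        simp only [dotProduct, sq]
    _ ≤ _ := by
        simp only [dotProduct_sub (_ - _), sub_dotProduct (A *ᵥ _),
          dotProduct_smul, smul_dotProduct, smul_eq_mul]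
        rw [dotProduct_comm (A *ᵥ (x' - y)) (x' - y)]
        have h2 := mulVec_sq_le hA (x' - y)
        have h3 := form_nonneg hA (x' - y)
        nlinarith [mul_le_mul_of_nonneg_right htL h3]

/-! ### The calls of TPCG1 -/

lemma self_mem_feasible (x : Fin n → ℝ) : x ∈ feasible (zeros x) (negs x) (poss x) :=
  ⟨fun _ hj => mem_zeros.1 hj, fun _ hj => (Finset.mem_filter.1 hj).2.le,
    fun _ hj => (Finset.mem_filter.1 hj).2.le⟩

lemma signVec_mul (A : Matrix (Fin n) (Fin n) ℝ) (b : Fin n → ℝ) (τ : ℝ) {x y : Fin n → ℝ}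
    (hy : y ∈ feasible (zeros x) (negs x) (poss x)) (i : Fin n) :
    signVec A b τ x i * y i = τ * |y i| := by
  rcases lt_trichotomy (x i) 0 with h | h | h
  · rw [abs_of_nonpos (hy.2.1 i (by simp [negs, h]))]
    simp [signVec, h, h.not_gt, h.ne]
  · simp [hy.1 i (mem_zeros.2 h)]
  · rw [abs_of_nonneg (hy.2.2 i (by simp [poss, h]))]
    simp [signVec, h]

lemma quad_signVec (A : Matrix (Fin n) (Fin n) ℝ) (b : Fin n → ℝ) (τ : ℝ) {x y : Fin n → ℝ}
    (hy : y ∈ feasible (zeros x) (negs x) (poss x)) :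
    quad A (b - signVec A b τ x) y = objective A b τ y :=
  quad_sub_right_eq_objective (signVec_mul A b τ hy)

lemma coordProj_grad_signVec {x y : Fin n → ℝ}
    (hy : y ∈ feasible (zeros x) (negs x) (poss x)) (hz : zeros y = zeros x) :
    coordProj (zeros x) (grad A (b - signVec A b τ x) y) =
      coordProj (zeros y) (minSubgrad A b τ y) := by
  rw [hz]
  ext i
  by_cases hi : i ∈ zeros x
  · simp [coordProj, hi]
  · have hyi : y i ≠ 0 := fun h0 => hi (hz ▸ mem_zeros.2 h0)
    have h1 := mul_right_cancel₀ hyi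
      ((minSubgrad_sub_grad_mul (A := A) (b := b) y i).trans (signVec_mul A b τ hy i).symm)
    simp only [coordProj, hi, if_false]
    simp only [grad, Pi.sub_apply] at h1 ⊢
    linarith

lemma coordProj_sq_le (J : Finset (Fin n)) (r : Fin n → ℝ) {δ : ℝ}
    (h : ‖coordProj J r‖ ≤ δ) : coordProj J r ⬝ᵥ coordProj J r ≤ n * δ ^ 2 := by
  calc _ ≤ ∑ _i : Fin n, δ ^ 2 := by
        refine Finset.sum_le_sum fun i _ => ?_
        rw [← sq, ← sq_abs]
        gcongr
        exact (norm_le_pi_norm (coordProj J r) i).trans h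
    _ = _ := by simp

/-- On Ω the CG model is `F` itself. If no new zero appeared, the exit cannot have been a
truncation, so the residual test was met, and the free part of `v(y)` is that residual. -/
theorem TPCG1_spec (hA : A.PosSemidef) {x y : Fin n → ℝ} {δ : ℝ}
    (hy : TPCG1 A b (signVec A b τ x) (zeros x) (negs x) (poss x) x δ y) :
    zeros x ⊆ zeros y ∧ objective A b τ y ≤ objective A b τ x ∧
      (zeros y = zeros x → subNorm (zeros y)ᶜ (minSubgrad A b τ y) ^ 2 ≤ n * δ ^ 2) := by
  obtain ⟨h1, h2, h3⟩ := CGReturns.spec hA hy (cgInv_init A b _ _ x) (self_mem_feasible x)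
  refine ⟨zeros_subset_of_mem h1.1, ?_, fun hz => ?_⟩
  · rw [quad_signVec A b τ h1] at h2
    refine h2.trans (quad_signVec A b τ (self_mem_feasible x)).le
  · rcases h3 with ⟨i, hi, hi0⟩ | h3
    · have := mem_zeros.1 (hz ▸ mem_zeros.2 hi0 : i ∈ zeros x)
      simp [negs, poss, this] at hi
    · rw [coordProj_grad_signVec h1 hz] at h3
      rw [subNorm_sq, ← coordProj_sq]
      exact coordProj_sq_le _ _ h3

/-- The positive free part of `v(x)` is what makes the initial residual nonzero, as the first step
length requires. -/
theorem exists_TPCG1 (hA : A.PosSemidef) (hopt : ∃ xs, IsOptimal A b τ xs) {x : Fin n → ℝ} {δ : ℝ}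
    (hδ : 0 ≤ δ) (hx : 0 < subNorm (zeros x)ᶜ (minSubgrad A b τ x)) :
    ∃ y, TPCG1 A b (signVec A b τ x) (zeros x) (negs x) (poss x) x δ y := by
  obtain ⟨xs, hxs⟩ := hopt
  refine (cgInv_init A b (signVec A b τ x) (zeros x) x).exists_cgReturns hA hδ
    (m := objective A b τ xs) (fun z hz => ?_) ?_ (self_mem_feasible x)
  · rw [quad_signVec A b τ hz]
    exact hxs z
  · intro h0
    rw [(cgInv_init A b (signVec A b τ x) (zeros x) x).p_eq,
      (cgInv_init A b (signVec A b τ x) (zeros x) x).r_eq] at h0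
    have h1 : coordProj (zeros x) (grad A (b - signVec A b τ x) x) = 0 := h0
    rw [coordProj_grad_signVec (self_mem_feasible x) rfl] at h1
    have h2 := subNorm_sq (zeros x)ᶜ (minSubgrad A b τ x)
    rw [← coordProj_sq, h1, zero_dotProduct] at h2
    exact hx.ne' (pow_eq_zero_iff two_ne_zero |>.1 h2)

lemma cgTol_nonneg (A : Matrix (Fin n) (Fin n) ℝ) (ht : 0 < t) {s : State n} (hε : 0 ≤ s.epsHat) :
    0 ≤ cgTol A t s := by
  have hL : 0 ≤ specNorm A := norm_nonneg _
  unfold cgTol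
  positivity

/-- The tolerance is chosen for this identity; the factor `n` pays for passing from the max norm to
the Euclidean norm. -/
lemma cgTol_sq (hn : 0 < n) (hA0 : A ≠ 0) (htL : specNorm A ≤ 2 * t⁻¹) (ht : 0 < t) {s : State n}
    (hη : 0 < s.etaHat) :
    s.etaHat * (t⁻¹ + specNorm A) ^ 2 * (n * cgTol A t s ^ 2) =
      (2 * t⁻¹ - specNorm A) * specNorm A * s.epsHat ^ 2 := by
  have hL := specNorm_pos hA0
  have ht' : 0 < t⁻¹ := inv_pos.2 ht
  have hn' : (0 : ℝ) < n := by exact_mod_cast hn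
  unfold cgTol
  rw [div_pow, mul_pow, mul_pow, Real.sq_sqrt (mul_nonneg (by linarith) hL.le),
    Real.sq_sqrt (by positivity)]
  field_simp

/-- One conjugate gradient and proximal gradient step. -/
theorem cgProx_spec (hA : A.PosSemidef) (hA0 : A ≠ 0) (hn : 0 < n) (hτ : 0 ≤ τ)
    (hopt : ∃ xs, IsOptimal A b τ xs) (ht : 0 < t) (htL : specNorm A < 2 * t⁻¹) {x0 : Fin n → ℝ}
    {ηs : ℝ} (hηs : ηs ∈ errorBoundConstants A b τ x0) {s : State n} (hη : 0 < s.etaHat)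
    (hx0 : objective A b τ s.x ≤ objective A b τ x0) {y x' : Fin n → ℝ}
    (hcg : TPCG1 A b (signVec A b τ s.x) (zeros s.x) (negs s.x) (poss s.x) s.x (cgTol A t s) y)
    (hface : x' ∈ coordSubspace (zeros y))
    (hprox : ∀ z ∈ coordSubspace (zeros y),
      proxObjective A b τ t y x' ≤ proxObjective A b τ t y z) :
    objective A b τ x' ≤ objective A b τ s.x ∧ zeros s.x ⊆ zeros x' ∧
      (zeros x' = zeros s.x →
        s.etaHat * subNorm (zeros x')ᶜ (minSubgrad A b τ x') ^ 2 ≤ ηs * s.epsHat ^ 2 ∧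
        s.etaHat * subNorm (zeros x')ᶜ (minSubgrad A b τ x') ^ 2 ≤ s.epsHat ^ 2) := by
  obtain ⟨u, ω, hu⟩ := exists_isProxStep A b hτ ht y
  obtain rfl := hu.eq_of_isMin ht hface hprox
  obtain ⟨hsub, hle, hgrad⟩ := TPCG1_spec hA hcg
  have hdec := hu.objective_add_le hA ht
  have hL := specNorm_pos hA0
  have hZ := dotProduct_self_nonneg (x' - y)
  have hsub' : zeros y ⊆ zeros x' := zeros_subset_of_mem hface
  have ht' : 0 < t⁻¹ := inv_pos.2 ht
  refine ⟨by nlinarith, hsub.trans hsub', fun hz => ?_⟩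
  have hyz : zeros y = zeros s.x := (hsub'.trans hz.le).antisymm hsub
  have h1 := hu.sq_minSubgrad_le hA ht htL.le (hz.trans hyz.symm)
  have h2 := hu.sq_sub_le hτ ht
  have h3 := hgrad hyz
  have h4 := cgTol_sq hn hA0 htL.le ht hη
  have h5 := hηs.2 y (hle.trans hx0)
  have h6 := faceMin_le hopt hface
  set L := specNorm A
  set G := subNorm (zeros x')ᶜ (minSubgrad A b τ x') ^ 2
  set V := subNorm (zeros y)ᶜ (minSubgrad A b τ y) ^ 2
  set Z := (x' - y) ⬝ᵥ (x' - y)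
  have hηs0 : 0 ≤ ηs := hηs.1
  have hq : 0 < (2 * t⁻¹ - L) * L := mul_pos (by linarith) hL
  have hc : 0 < s.etaHat * (t⁻¹ + L) ^ 2 := by positivity
  have h7 : s.etaHat * (t⁻¹ + L) ^ 2 * V ≤ (2 * t⁻¹ - L) * L * s.epsHat ^ 2 := by
    rw [← h4]
    gcongr
  -- As `x'` lies in ℋ(y), the proximal decrease is at most `F(y) - F*_y`, to which the error bound
  -- at `y` applies.
  have h8 : (2 * t⁻¹ - L) * L * Z ≤ ηs * V := by
    have h9 : (t⁻¹ - L / 2) * Z ≤ ηs / (2 * L) * V := by linarith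
    have h10 : ηs / (2 * L) * V * (2 * L) = ηs * V := by field_simp
    nlinarith [mul_le_mul_of_nonneg_right h9 (by positivity : 0 ≤ 2 * L)]
  constructor
  · have h11 : (2 * t⁻¹ - L) * L * (s.etaHat * (t⁻¹ + L) ^ 2 * Z) ≤
        (2 * t⁻¹ - L) * L * (ηs * s.epsHat ^ 2) := by
      calc _ = s.etaHat * (t⁻¹ + L) ^ 2 * ((2 * t⁻¹ - L) * L * Z) := by ring
        _ ≤ s.etaHat * (t⁻¹ + L) ^ 2 * (ηs * V) := by gcongr
        _ = ηs * (s.etaHat * (t⁻¹ + L) ^ 2 * V) := by ring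
        _ ≤ ηs * ((2 * t⁻¹ - L) * L * s.epsHat ^ 2) := by gcongr
        _ = _ := by ring
    calc s.etaHat * G ≤ s.etaHat * ((t⁻¹) ^ 2 * Z) := by gcongr
      _ ≤ s.etaHat * ((t⁻¹ + L) ^ 2 * Z) := by gcongr; linarith
      _ = s.etaHat * (t⁻¹ + L) ^ 2 * Z := by ring
      _ ≤ _ := le_of_mul_le_mul_left h11 hq
  · have hGV : G ≤ V := by
      calc G ≤ (t⁻¹) ^ 2 * Z := h1
        _ ≤ (t⁻¹) ^ 2 * (t ^ 2 * V) := by gcongr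
        _ = V := by field_simp
    have h9 : (2 * t⁻¹ - L) * L ≤ (t⁻¹ + L) ^ 2 := by nlinarith
    have h10 : (t⁻¹ + L) ^ 2 * (s.etaHat * V) ≤ (t⁻¹ + L) ^ 2 * s.epsHat ^ 2 := by
      calc _ = s.etaHat * (t⁻¹ + L) ^ 2 * V := by ring
        _ ≤ (2 * t⁻¹ - L) * L * s.epsHat ^ 2 := h7
        _ ≤ _ := by gcongr
    calc s.etaHat * G ≤ s.etaHat * V := by gcongr
      _ ≤ _ := le_of_mul_le_mul_left h10 (by positivity)

/-! ### The tests of the method -/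

lemma subNorm_nonneg (J : Finset (Fin n)) (v : Fin n → ℝ) : 0 ≤ subNorm J v := Real.sqrt_nonneg _

lemma sq_le_subNorm_sq {J : Finset (Fin n)} {v : Fin n → ℝ} {i : Fin n} (hi : i ∈ J) :
    v i ^ 2 ≤ subNorm J v ^ 2 := by
  rw [subNorm_sq]
  exact Finset.single_le_sum (f := fun i => v i ^ 2) (fun j _ => sq_nonneg _) hi

lemma not_releaseTest_sq {s : State n} (hη : 0 ≤ s.etaHat) (h : ¬ ReleaseTest A b τ s) :
    subNorm (zeros s.x) (minSubgrad A b τ s.x) ^ 2 ≤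
      s.etaHat * subNorm (zeros s.x)ᶜ (minSubgrad A b τ s.x) ^ 2 := by
  rw [ReleaseTest, not_lt] at h
  have := pow_le_pow_left₀ (Real.sqrt_nonneg _) h 2
  rwa [mul_pow, Real.sq_sqrt hη] at this

lemma releaseTest_sq {s : State n} (hη : 0 ≤ s.etaHat) (h : ReleaseTest A b τ s) :
    s.etaHat * subNorm (zeros s.x)ᶜ (minSubgrad A b τ s.x) ^ 2 <
      subNorm (zeros s.x) (minSubgrad A b τ s.x) ^ 2 := by
  rw [ReleaseTest] at h
  have := pow_lt_pow_left₀ h (mul_nonneg (Real.sqrt_nonneg _) (subNorm_nonneg _ _)) two_ne_zero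
  rwa [mul_pow, Real.sq_sqrt hη] at this

/-- A failed release test bounds the zero part of `v` by √η̂ times the free part, so the free part
must be small both as it is and after this scaling. -/
lemma stops_of_not_releaseTest {ε : ℝ} (hε : 0 ≤ ε) {s : State n} (hη : 0 ≤ s.etaHat)
    (h : ¬ ReleaseTest A b τ s)
    (h1 : subNorm (zeros s.x)ᶜ (minSubgrad A b τ s.x) ^ 2 ≤ ε ^ 2)
    (h2 : s.etaHat * subNorm (zeros s.x)ᶜ (minSubgrad A b τ s.x) ^ 2 ≤ ε ^ 2) :
    Stops A b τ ε s := by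
  refine (pi_norm_le_iff_of_nonneg hε).2 fun i => abs_le_of_sq_le_sq ?_ hε
  by_cases hi : i ∈ zeros s.x
  · exact (sq_le_subNorm_sq hi).trans ((not_releaseTest_sq hη h).trans h2)
  · exact (sq_le_subNorm_sq (Finset.mem_compl.2 hi)).trans h1

lemma subNorm_compl_pos {ε : ℝ} (hε : 0 ≤ ε) {s : State n} (hη : 0 ≤ s.etaHat)
    (h : ¬ ReleaseTest A b τ s) (hrun : ¬ Stops A b τ ε s) :
    0 < subNorm (zeros s.x)ᶜ (minSubgrad A b τ s.x) := by
  refine (subNorm_nonneg _ _).lt_of_ne fun h0 => hrun ?_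
  refine stops_of_not_releaseTest hε hη h ?_ ?_ <;> rw [← h0] <;> simp [sq_nonneg]

theorem exists_step (hA : A.PosSemidef) (hτ : 0 ≤ τ) (hopt : ∃ xs, IsOptimal A b τ xs)
    (ht : 0 < t) (ρ ξ : ℝ) {ε : ℝ} (hε : 0 ≤ ε) {s : State n}
    (hη : 0 ≤ s.etaHat) (hεs : 0 ≤ s.epsHat) (hrun : ¬ Stops A b τ ε s) :
    ∃ s', Step A b τ t ρ ξ ε s s' := by
  by_cases hmeas : ReleaseTest A b τ s
  · by_cases hmem : ∃ S ∈ s.family, S ⊆ zeros s.x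
    · exact ⟨_, .enlarge s hrun hmeas hmem⟩
    · refine ⟨_, .lineSearch s hrun hmeas hmem (form_projSubgrad_ne_zero hA hτ hopt ?_)⟩
      rw [projSubgrad_sq]
      exact (mul_nonneg hη (sq_nonneg _)).trans_lt (releaseTest_sq hη hmeas)
  · obtain ⟨y, hy⟩ := exists_TPCG1 hA hopt (cgTol_nonneg A ht hεs)
      (subNorm_compl_pos hε hη hmeas hrun)
    obtain ⟨x', ω, hx'⟩ := exists_isProxStep A b hτ ht y
    exact ⟨_, .cgProx s y x' hrun hmeas hy hx'.mem (hx'.isMin ht)⟩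

theorem Step.unique (hτ : 0 ≤ τ) (ht : 0 < t) {ρ ξ ε : ℝ} {s s₁ s₂ : State n}
    (h₁ : Step A b τ t ρ ξ ε s s₁) (h₂ : Step A b τ t ρ ξ ε s s₂) : s₁ = s₂ := by
  cases h₁ with
  | enlarge hrun hmeas hmem =>
    cases h₂ with
    | enlarge _ _ _ => rfl
    | lineSearch _ _ hmem' _ => exact absurd hmem hmem'
    | cgProx _ _ _ hmeas' _ _ _ => exact absurd hmeas hmeas'
  | lineSearch hrun hmeas hmem hden =>
    cases h₂ with
    | enlarge _ _ hmem' => exact absurd hmem' hmem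
    | lineSearch _ _ _ _ => rfl
    | cgProx _ _ _ hmeas' _ _ _ => exact absurd hmeas hmeas'
  | cgProx y x' hrun hmeas hcg hface hprox =>
    cases h₂ with
    | enlarge _ hmeas' _ => exact absurd hmeas' hmeas
    | lineSearch _ hmeas' _ _ => exact absurd hmeas' hmeas
    | cgProx y₂ x₂ _ _ hcg₂ hface₂ hprox₂ =>
      obtain rfl := CGReturns.unique hcg hcg₂
      obtain ⟨u, ω, hu⟩ := exists_isProxStep A b hτ ht y
      rw [hu.eq_of_isMin ht hface hprox, hu.eq_of_isMin ht hface₂ hprox₂]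

end GCG

namespace GCG

variable {n : ℕ} {A : Matrix (Fin n) (Fin n) ℝ} {b : Fin n → ℝ} {τ t η0 ρ ξ ε ηs : ℝ}
  {x0 : Fin n → ℝ} {K B k p j β : ℕ} {s s' : State n}

/-! ### Counting the iterations -/

theorem lineSearch_spec (hA : A.PosSemidef) (hA0 : A ≠ 0) (hτ : 0 ≤ τ) (hη : 0 ≤ s.etaHat)
    (hmeas : ReleaseTest A b τ s)
    (hden : projSubgrad A b τ s.x ⬝ᵥ A *ᵥ projSubgrad A b τ s.x ≠ 0) {z : Fin n → ℝ}
    (hz : z = s.x - ((projSubgrad A b τ s.x ⬝ᵥ projSubgrad A b τ s.x) /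
        (projSubgrad A b τ s.x ⬝ᵥ A *ᵥ projSubgrad A b τ s.x)) • projSubgrad A b τ s.x) :
    objective A b τ z < objective A b τ s.x -
      s.etaHat / (2 * specNorm A) * subNorm (zeros s.x)ᶜ (minSubgrad A b τ s.x) ^ 2 := by
  have h1 := objective_lineSearch_le (b := b) hA hA0 hτ hden
  rw [← hz, projSubgrad_sq] at h1
  have h2 := releaseTest_sq hη hmeas
  have hL := specNorm_pos hA0
  have h3 := div_lt_div_of_pos_right h2 (by positivity : 0 < 2 * specNorm A)
  rw [div_mul_eq_mul_div]
  linarith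

lemma card_le_of_empty_notMem {F : Finset (Finset (Fin n))} (h : ∅ ∉ F) : F.card ≤ 2 ^ n - 1 := by
  have h1 : F ⊆ Finset.univ.erase ∅ := fun S hS =>
    Finset.mem_erase.2 ⟨fun h0 => h (h0 ▸ hS), Finset.mem_univ _⟩
  have h2 := Finset.card_le_card h1
  rwa [Finset.card_erase_of_mem (Finset.mem_univ _), Finset.card_univ, Fintype.card_finset,
    Fintype.card_fin] at h2

lemma card_lt_of_univ_notMem (hn : 0 < n) {F : Finset (Finset (Fin n))} (h : ∅ ∉ F)
    (hu : Finset.univ ∉ F) : F.card + 1 ≤ 2 ^ n - 1 := by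
  rw [← Finset.card_insert_of_notMem hu]
  refine card_le_of_empty_notMem fun h0 => ?_
  rcases Finset.mem_insert.1 h0 with h1 | h1
  · have := congrArg Finset.card h1
    simp at this
    omega
  · exact h h1

/-- The number of steps of a run, beyond one per face, that may fail to be final: `K` as long as
`η̂ < η*`, and `0` afterwards. -/
noncomputable def extraSteps (ηs : ℝ) (K : ℕ) (s : State n) : ℕ := if ηs ≤ s.etaHat then 0 else K

/-- The invariant of the method. Here `p` counts the enlargements of `η̂`, `j` the steps of the
current run, and `β = 1` if the origin was released before the last enlargement, which happens at
most once. -/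
structure LoopInv (A : Matrix (Fin n) (Fin n) ℝ) (b : Fin n → ℝ) (τ : ℝ) (x0 : Fin n → ℝ)
    (η0 ρ ξ ε ηs : ℝ) (K B k : ℕ) (s : State n) (p j β : ℕ) : Prop where
  eta_eq : s.etaHat = η0 * ρ ^ p
  eps_eq : s.epsHat = ξ ^ j * ε
  le_init : objective A b τ s.x ≤ objective A b τ x0
  flag : β = 0 ∨ β = 1 ∧ objective A b τ s.x < objective A b τ 0
  univ_mem : Finset.univ ∈ s.family → β = 0 ∧ objective A b τ s.x < objective A b τ 0
  empty_notMem : ∅ ∉ s.family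
  barrier : ηs ≤ s.etaHat → ∀ S ∈ s.family, ∀ z ∈ coordSubspace S,
    objective A b τ s.x < objective A b τ z
  phase : p = 0 ∨ η0 * ρ ^ (p - 1) < ηs
  -- One pass above the allowance is possible only in a state where the run is over. The strict `<
  -- n` there keeps `j ≤ extraSteps + n` in both cases.
  run : j ≤ extraSteps ηs K s + (zeros s.x).card ∨
    j ≤ extraSteps ηs K s + (zeros s.x).card + 1 ∧ (zeros s.x).card < n ∧
      (Stops A b τ ε s ∨ ReleaseTest A b τ s)
  -- A budget `B` per finished phase, the overdraft `K`, then for each release in this phase the run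
  -- before it and the release itself, and finally the current run.
  count : k ≤ p * B + β * K + s.family.card * (extraSteps ηs K s + n + 1) + j

lemma card_zeros_le (x : Fin n → ℝ) : (zeros x).card ≤ n := by
  simpa using Finset.card_le_univ (zeros x)

lemma LoopInv.run_le (h : LoopInv A b τ x0 η0 ρ ξ ε ηs K B k s p j β) :
    j ≤ extraSteps ηs K s + n := by
  have := card_zeros_le s.x
  rcases h.run with h1 | ⟨h1, h2, -⟩ <;> omega

lemma LoopInv.le_etaHat (h : LoopInv A b τ x0 η0 ρ ξ ε ηs K B k s p j β) (hη0 : 0 < η0)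
    (hρ : 1 < ρ) : η0 ≤ s.etaHat := by
  rw [h.eta_eq]
  exact le_mul_of_one_le_right hη0.le (one_le_pow₀ hρ.le)

theorem LoopInv.init : LoopInv A b τ x0 η0 ρ ξ ε ηs K B 0 ⟨x0, η0, ε, ∅⟩ 0 0 0 where
  eta_eq := by simp
  eps_eq := by simp
  le_init := le_rfl
  flag := Or.inl rfl
  univ_mem := by simp
  empty_notMem := by simp
  barrier := by simp
  phase := Or.inl rfl
  run := Or.inl (Nat.zero_le _)
  count := Nat.zero_le _

/-- By `barrier` a recurring face is impossible once η* ≤ η̂. Without the full index set, the family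
has room for one more member, which pays for the last run and the enlargement; with it, `n ≤ 2 ^ n -
1` leaves an excess of at most `K`, charged to `β'`. -/
theorem LoopInv.enlarge (hn : 0 < n) (hB : B = 1 + (K + n + 2) * (2 ^ n - 1))
    (h : LoopInv A b τ x0 η0 ρ ξ ε ηs K B k s p j β) (hmem : ∃ S ∈ s.family, S ⊆ zeros s.x) :
    ∃ β', LoopInv A b τ x0 η0 ρ ξ ε ηs K B (k + 1) ⟨s.x, ρ * s.etaHat, ε, ∅⟩ (p + 1) 0 β' := by
  have hlt : s.etaHat < ηs := by
    by_contra! hle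
    obtain ⟨S, hS, hsub⟩ := hmem
    exact lt_irrefl _ (h.barrier hle S hS s.x (mem_coordSubspace_of_subset hsub))
  have hK : extraSteps ηs K s = K := if_neg (not_le.2 hlt)
  have hj := h.run_le
  have hc := h.count
  rw [hK] at hj hc
  have hnN : n ≤ 2 ^ n - 1 := Nat.le_pred_of_lt Nat.lt_two_pow_self
  set N := 2 ^ n - 1 with hN
  obtain ⟨β', hflag, hcount⟩ : ∃ β', (β' = 0 ∨ β' = 1 ∧ objective A b τ s.x < objective A b τ 0) ∧
      k + 1 ≤ (p + 1) * B + β' * K := by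
    by_cases hu : Finset.univ ∈ s.family
    · obtain ⟨rfl, hlt0⟩ := h.univ_mem hu
      refine ⟨1, Or.inr ⟨rfl, hlt0⟩, ?_⟩
      have h1 := Nat.mul_le_mul_right (K + n + 1) (card_le_of_empty_notMem h.empty_notMem)
      rw [← hN] at h1
      have h2 : (p + 1) * B = p * B + 1 + N * (K + n + 1) + N := by rw [hB]; ring
      omega
    · refine ⟨β, h.flag, ?_⟩
      have h1 := Nat.mul_le_mul_right (K + n + 1) (card_lt_of_univ_notMem hn h.empty_notMem hu)
      rw [← hN, add_mul, one_mul] at h1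
      have h2 : (p + 1) * B = p * B + 1 + N * (K + n + 1) + N := by rw [hB]; ring
      omega
  exact ⟨β', by rw [h.eta_eq]; ring, by simp, h.le_init, hflag, by simp, by simp, by simp,
    Or.inr (by rw [Nat.add_sub_cancel, ← h.eta_eq]; exact hlt), Or.inl (Nat.zero_le _),
    by simpa using hcount⟩

/-- For the new member of the family, `barrier` is the release decrease set against the error bound
at `s.x`. The origin cannot be released when `β = 1`, because `F` is already below `F(0)`. -/
theorem LoopInv.lineSearch (hA : A.PosSemidef) (hA0 : A ≠ 0) (hτ : 0 ≤ τ)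
    (hopt : ∃ xs, IsOptimal A b τ xs) (hη0 : 0 < η0) (hρ : 1 < ρ)
    (hηs : ηs ∈ errorBoundConstants A b τ x0)
    (h : LoopInv A b τ x0 η0 ρ ξ ε ηs K B k s p j β) (hmeas : ReleaseTest A b τ s)
    (hmem : ¬ ∃ S ∈ s.family, S ⊆ zeros s.x)
    (hden : projSubgrad A b τ s.x ⬝ᵥ A *ᵥ projSubgrad A b τ s.x ≠ 0) {z : Fin n → ℝ}
    (hz : z = s.x - ((projSubgrad A b τ s.x ⬝ᵥ projSubgrad A b τ s.x) /
        (projSubgrad A b τ s.x ⬝ᵥ A *ᵥ projSubgrad A b τ s.x)) • projSubgrad A b τ s.x) :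
    LoopInv A b τ x0 η0 ρ ξ ε ηs K B (k + 1)
      ⟨z, s.etaHat, ε, insert (zeros s.x) s.family⟩ p 0 β := by
  have hη := hη0.trans_le (h.le_etaHat hη0 hρ)
  have hL := specNorm_pos hA0
  have hdec := lineSearch_spec hA hA0 hτ hη.le hmeas hden hz
  have hlt : objective A b τ z < objective A b τ s.x := by
    refine hdec.trans_le (sub_le_self _ ?_)
    positivity
  have hnot : zeros s.x ∉ s.family := fun h0 => hmem ⟨_, h0, Finset.Subset.refl _⟩
  refine ⟨h.eta_eq, by simp, hlt.le.trans h.le_init, h.flag.imp_right (And.imp_right hlt.trans),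
    fun hu => ?_, fun he => ?_, fun hle S hS w hw => ?_, h.phase, Or.inl (Nat.zero_le _), ?_⟩
  · rcases Finset.mem_insert.1 hu with hu | hu
    · have hx : s.x = 0 := by
        ext i
        exact mem_zeros.1 (hu ▸ Finset.mem_univ i)
      have h0 : objective A b τ z < objective A b τ 0 := hx ▸ hlt
      exact ⟨h.flag.resolve_right fun hβ => lt_irrefl _ (hx ▸ hβ.2), h0⟩
    · exact (h.univ_mem hu).imp_right hlt.trans
  · rcases Finset.mem_insert.1 he with he | he
    · have h1 := releaseTest_sq hη.le hmeas
      rw [← he, subNorm_sq ∅, Finset.sum_empty] at h1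
      exact absurd h1 (not_lt.2 (by positivity))
    · exact h.empty_notMem he
  · rcases Finset.mem_insert.1 hS with rfl | hS
    · have h1 := hηs.2 s.x h.le_init
      have h2 := faceMin_le hopt hw
      have h3 : ηs / (2 * specNorm A) * subNorm (zeros s.x)ᶜ (minSubgrad A b τ s.x) ^ 2 ≤
          s.etaHat / (2 * specNorm A) * subNorm (zeros s.x)ᶜ (minSubgrad A b τ s.x) ^ 2 := by
        gcongr
      change objective A b τ z < _
      linarith
    · exact hlt.trans (h.barrier hle S hS w hw)
  · have h1 := h.run_le
    have h2 := h.count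
    change k + 1 ≤ p * B + β * K + (insert (zeros s.x) s.family).card *
      (extraSteps ηs K s + n + 1) + 0
    rw [Finset.card_insert_of_notMem hnot, add_mul, one_mul]
    omega

lemma le_sq_and_mul_le_sq {η g : ℝ} (hη : 0 < η) (hξ0 : 0 ≤ ξ) (hξ1 : ξ ≤ 1) (hg : 0 ≤ g)
    (h1 : η * g ≤ ηs * (ξ ^ j * ε) ^ 2) (h2 : η * g ≤ (ξ ^ j * ε) ^ 2)
    (h : ηs ≤ η ∨ ηs * (ξ ^ j) ^ 2 ≤ η) : g ≤ ε ^ 2 ∧ η * g ≤ ε ^ 2 := by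
  have h3 : (ξ ^ j * ε) ^ 2 ≤ ε ^ 2 := by
    rw [mul_pow]
    exact mul_le_of_le_one_left (sq_nonneg _) (pow_le_one₀ (by positivity) (pow_le_one₀ hξ0 hξ1))
  refine ⟨?_, h2.trans h3⟩
  rcases h with h | h
  · rcases le_total 1 η with h4 | h4
    · exact (le_mul_of_one_le_left hg h4).trans (h2.trans h3)
    · refine le_of_mul_le_mul_left ?_ hη
      calc η * g ≤ ηs * (ξ ^ j * ε) ^ 2 := h1
        _ ≤ η * (ξ ^ j * ε) ^ 2 := by gcongr
        _ ≤ η * ε ^ 2 := by gcongr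
  · refine le_of_mul_le_mul_left ?_ hη
    calc η * g ≤ ηs * (ξ ^ j * ε) ^ 2 := h1
      _ = ηs * (ξ ^ j) ^ 2 * ε ^ 2 := by ring
      _ ≤ η * ε ^ 2 := by gcongr

theorem LoopInv.cgProx (hA : A.PosSemidef) (hA0 : A ≠ 0) (hn : 0 < n) (hτ : 0 ≤ τ)
    (hopt : ∃ xs, IsOptimal A b τ xs) (ht : 0 < t) (htL : specNorm A < 2 * t⁻¹) (hη0 : 0 < η0)
    (hρ : 1 < ρ) (hξ : ξ ∈ Set.Ioo (0 : ℝ) 1) (hε : 0 ≤ ε)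
    (hηs : ηs ∈ errorBoundConstants A b τ x0)
    (hK : ∀ i ≥ K, ηs * (ξ ^ i) ^ 2 ≤ η0)
    (h : LoopInv A b τ x0 η0 ρ ξ ε ηs K B k s p j β) (hrun : ¬ Stops A b τ ε s)
    (hmeas : ¬ ReleaseTest A b τ s) {y x' : Fin n → ℝ}
    (hcg : TPCG1 A b (signVec A b τ s.x) (zeros s.x) (negs s.x) (poss s.x) s.x (cgTol A t s) y)
    (hface : x' ∈ coordSubspace (zeros y))
    (hprox : ∀ z ∈ coordSubspace (zeros y),
      proxObjective A b τ t y x' ≤ proxObjective A b τ t y z) :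
    LoopInv A b τ x0 η0 ρ ξ ε ηs K B (k + 1) ⟨x', s.etaHat, ξ * s.epsHat, s.family⟩
      p (j + 1) β := by
  have hη0η := h.le_etaHat hη0 hρ
  have hη := hη0.trans_le hη0η
  obtain ⟨hle, hsub, hfin⟩ :=
    cgProx_spec hA hA0 hn hτ hopt ht htL hηs hη h.le_init hcg hface hprox
  refine ⟨h.eta_eq, by rw [h.eps_eq]; ring, hle.trans h.le_init,
    h.flag.imp_right (And.imp_right hle.trans_lt), fun hu => (h.univ_mem hu).imp_right hle.trans_lt,
    h.empty_notMem, fun hle' S hS w hw => hle.trans_lt (h.barrier hle' S hS w hw), h.phase, ?_, ?_⟩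
  · have hj : j ≤ extraSteps ηs K s + (zeros s.x).card :=
      h.run.resolve_right fun h0 => h0.2.2.elim hrun hmeas
    change j + 1 ≤ extraSteps ηs K s + (zeros x').card ∨
      j + 1 ≤ extraSteps ηs K s + (zeros x').card + 1 ∧ (zeros x').card < n ∧ _
    by_cases hz : zeros x' = zeros s.x
    · rw [hz]
      rcases lt_or_ge j (extraSteps ηs K s) with hjK | hjK
      · left; omega
      refine Or.inr ⟨by omega, ?_, ?_⟩
      -- At the origin the free part is empty, and a failed release test would then have stopped the
      -- method.
      · refine (card_zeros_le s.x).lt_of_ne fun hcard => ?_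
        have huniv : zeros s.x = Finset.univ :=
          (Finset.card_eq_iff_eq_univ _).1 (by rw [hcard, Fintype.card_fin])
        have hpos := subNorm_compl_pos hε hη.le hmeas hrun
        rw [huniv] at hpos
        simp [subNorm] at hpos
      · obtain ⟨h1, h2⟩ := hfin hz
        obtain ⟨h3, h4⟩ := le_sq_and_mul_le_sq hη hξ.1.le hξ.2.le (sq_nonneg _)
          (h.eps_eq ▸ h1) (h.eps_eq ▸ h2) (by
            rcases le_or_gt ηs s.etaHat with hle' | hlt'
            · exact Or.inl hle'
            · rw [extraSteps, if_neg (not_le.2 hlt')] at hjK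
              exact Or.inr ((hK j hjK).trans hη0η))
        by_contra! hnot
        exact hnot.1 (stops_of_not_releaseTest hε hη.le hnot.2 h3 h4)
    · left
      have := Finset.card_lt_card (hsub.ssubset_of_ne (Ne.symm hz))
      omega
  · have := h.count
    change k + 1 ≤ p * B + β * K + s.family.card * (extraSteps ηs K s + n + 1) + (j + 1)
    omega

theorem exists_loopInv (hA : A.PosSemidef) (hA0 : A ≠ 0) (hn : 0 < n) (hτ : 0 ≤ τ)
    (hopt : ∃ xs, IsOptimal A b τ xs) (ht : 0 < t) (htL : specNorm A < 2 * t⁻¹) (hη0 : 0 < η0)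
    (hρ : 1 < ρ) (hξ : ξ ∈ Set.Ioo (0 : ℝ) 1) (hε : 0 ≤ ε)
    (hηs : ηs ∈ errorBoundConstants A b τ x0)
    (hK : ∀ i ≥ K, ηs * (ξ ^ i) ^ 2 ≤ η0)
    (hB : B = 1 + (K + n + 2) * (2 ^ n - 1)) (h : Reaches A b τ x0 t η0 ρ ξ ε k s) :
    ∃ p j β, LoopInv A b τ x0 η0 ρ ξ ε ηs K B k s p j β := by
  induction h with
  | init => exact ⟨0, 0, 0, LoopInv.init⟩
  | step k s s' _ hstep ih =>
    obtain ⟨p, j, β, h⟩ := ih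
    cases hstep with
    | enlarge hrun hmeas hmem =>
      obtain ⟨β', h'⟩ := h.enlarge hn hB hmem
      exact ⟨_, _, _, h'⟩
    | lineSearch hrun hmeas hmem hden =>
      exact ⟨_, _, _, h.lineSearch hA hA0 hτ hopt hη0 hρ hηs hmeas hmem hden rfl⟩
    | cgProx y x' hrun hmeas hcg hface hprox =>
      exact ⟨_, _, _, h.cgProx hA hA0 hn hτ hopt ht htL hη0 hρ hξ hε hηs hK hrun hmeas hcg hface
        hprox⟩

/-- If η* ≤ η̂, the current phase has no extra steps and the slack `K * (2 ^ n - 1)` in `B` covers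
the overdraft. Otherwise `p + 2 ≤ P` leaves two budgets for the current phase. -/
lemma LoopInv.le_mul (hn : 0 < n) (hB : B = 1 + (K + n + 2) * (2 ^ n - 1)) {P : ℕ}
    (hP1 : 1 ≤ P) (hP : ∀ q : ℕ, η0 * ρ ^ q < ηs → q + 2 ≤ P)
    (h : LoopInv A b τ x0 η0 ρ ξ ε ηs K B k s p j β) : k ≤ P * B := by
  have hj := h.run_le
  have hc := h.count
  have hnN : n ≤ 2 ^ n - 1 := Nat.le_pred_of_lt Nat.lt_two_pow_self
  have hcard := card_le_of_empty_notMem h.empty_notMem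
  have hβ : β * K ≤ K := by rcases h.flag with rfl | ⟨rfl, -⟩ <;> simp
  have hpP : p + 1 ≤ P := by
    rcases h.phase with rfl | h1
    · omega
    · have := hP _ h1
      omega
  have hPB := Nat.mul_le_mul_right B hpP
  have hu := card_lt_of_univ_notMem hn h.empty_notMem
  set N := 2 ^ n - 1
  have hB' : B = 1 + N * (K + n + 1) + N := by rw [hB]; ring
  have hKN : K ≤ K * N := Nat.le_mul_of_pos_right _ (by omega)
  rcases le_or_gt ηs s.etaHat with hle | hlt
  · rw [extraSteps, if_pos hle, zero_add] at hj hc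
    have h1 := Nat.mul_le_mul_right (n + 1) hcard
    have h2 : N * (K + n + 1) = N * (n + 1) + K * N := by ring
    have h3 : (p + 1) * B = p * B + B := by ring
    omega
  · rw [extraSteps, if_neg (not_le.2 hlt)] at hj hc
    have hpP' := Nat.mul_le_mul_right B (hP p (h.eta_eq ▸ hlt))
    have h2 : N * (K + n + 1) = N * (n + 1) + K * N := by ring
    have h3 : (p + 2) * B = p * B + B + B := by ring
    rcases h.flag with rfl | ⟨rfl, -⟩
    · have h1 := Nat.mul_le_mul_right (K + n + 1) hcard
      omega
    · have h1 := Nat.mul_le_mul_right (K + n + 1) (hu fun h0 => one_ne_zero (h.univ_mem h0).1)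
      rw [add_mul, one_mul] at h1
      omega

/-! ### The bounds of the theorem -/

lemma add_two_le_phaseBound (hη0 : 0 < η0) (hρ : 1 < ρ) {q : ℕ} (h : η0 * ρ ^ q < ηs) :
    (q : ℤ) + 2 ≤ phaseBound ηs η0 ρ := by
  have hρ0 : 0 < ρ := by linarith
  have hpos : 0 < η0 * ρ ^ q := by positivity
  have hlog := Real.log_lt_log hpos h
  rw [Real.log_mul hη0.ne' (by positivity), Real.log_pow] at hlog
  have h1 : (q : ℝ) < (Real.log ηs - Real.log η0) / Real.log ρ := by
    rw [lt_div_iff₀ (Real.log_pos hρ)]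
    linarith
  have h2 : (q : ℤ) < ⌈(Real.log ηs - Real.log η0) / Real.log ρ⌉ :=
    Int.lt_ceil.2 (by exact_mod_cast h1)
  rw [phaseBound, if_neg (hpos.trans h).ne']
  exact le_max_of_le_left (by omega)

lemma one_le_phaseBound (ηs η0 ρ : ℝ) : 1 ≤ phaseBound ηs η0 ρ := by
  unfold phaseBound
  split_ifs
  · exact le_rfl
  · exact le_max_right _ _

lemma exists_runBound_eq (n : ℕ) (hη0 : 0 < η0) (hηs : 0 ≤ ηs) (hξ : ξ ∈ Set.Ioo (0 : ℝ) 1) :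
    ∃ K : ℕ, runBound n ηs η0 ξ = K + n + 1 ∧ ∀ i ≥ K, ηs * (ξ ^ i) ^ 2 ≤ η0 := by
  rcases hηs.eq_or_lt with rfl | hpos
  · exact ⟨0, by simp [runBound], fun i _ => by simpa using hη0.le⟩
  set m := min (Real.log η0 - Real.log ηs) (-Real.log ηs) with hm
  refine ⟨⌈m / (2 * Real.log ξ)⌉.toNat, ?_, fun i hi => ?_⟩
  · rw [runBound, if_neg hpos.ne', ← hm, Int.toNat_eq_max]
    omega
  · have hlog : Real.log ξ < 0 := Real.log_neg hξ.1 hξ.2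
    have h1 : m / (2 * Real.log ξ) ≤ i := by
      have h2 : ⌈m / (2 * Real.log ξ)⌉ ≤ (i : ℤ) := Int.toNat_le.1 hi
      exact_mod_cast Int.ceil_le.1 h2
    rw [div_le_iff_of_neg (by linarith)] at h1
    have hξ0 := hξ.1
    rw [← Real.log_le_log_iff (by positivity) hη0, Real.log_mul hpos.ne' (by positivity),
      ← pow_mul, Real.log_pow]
    push_cast
    -- The entry `log η₀ - log η*` gives `η* ξ^(2i) ≤ η₀`; as η̂ ≥ η₀, this serves all phases.
    have := min_le_left (Real.log η0 - Real.log ηs) (-Real.log ηs)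
    linarith

theorem iterationBound_eq {P : ℕ} (hP : phaseBound ηs η0 ρ = P)
    (hK : runBound n ηs η0 ξ = K + n + 1) (hB : B = 1 + (K + n + 2) * (2 ^ n - 1)) :
    iterationBound n ηs η0 ρ ξ = (P * B : ℕ) := by
  rw [iterationBound, hP, hK, hB, Nat.cast_mul, Nat.cast_add, Nat.cast_mul,
    Nat.cast_sub Nat.one_le_two_pow]
  push_cast
  ring

end GCG

/-! ### Assembly of the theorem -/

theorem mainTheorem5 (n : ℕ) (A : Matrix (Fin n) (Fin n) ℝ) (hA : A.PosSemidef) (hA0 : A ≠ 0)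
    (b : Fin n → ℝ) (τ : ℝ) (hτ : 0 ≤ τ)
    (hopt : ∃ xs, GCG.IsOptimal A b τ xs)
    (x0 : Fin n → ℝ) (t η0 ρ ξ ε : ℝ)
    (ht : t ∈ Set.Ioo 0 (2 / GCG.specNorm A)) (hη0 : 0 < η0) (hρ : 1 < ρ)
    (hξ : ξ ∈ Set.Ioo (0 : ℝ) 1) (hε : 0 ≤ ε) :
    -- the smallest error bound constant exists
    (∃ ηs, IsLeast (GCG.errorBoundConstants A b τ x0) ηs) ∧
    -- the method is well defined: an iteration that does not stop has exactly one successor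
    (∀ k s, GCG.Reaches A b τ x0 t η0 ρ ξ ε k s → ¬ GCG.Stops A b τ ε s →
      ∃! s', GCG.Step A b τ t ρ ξ ε s s') ∧
    -- (i) it terminates within the stated number of iterations
    (∀ ηs, IsLeast (GCG.errorBoundConstants A b τ x0) ηs →
      ∃ k y, GCG.Returns A b τ x0 t η0 ρ ξ ε k y ∧ (k : ℤ) ≤ GCG.iterationBound n ηs η0 ρ ξ) ∧
    -- (ii) the output is approximately stationary, and optimal if `ε = 0`
    (∀ k y, GCG.Returns A b τ x0 t η0 ρ ξ ε k y →
      (∃ s ∈ GCG.subdiff A b τ y, ‖s‖ ≤ ε) ∧ (ε = 0 → GCG.IsOptimal A b τ y)) := by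
  have hn : 0 < n := by
    rcases Nat.eq_zero_or_pos n with rfl | hn
    · exact absurd (Subsingleton.elim A 0) hA0
    · exact hn
  have htL : GCG.specNorm A < 2 * t⁻¹ := by
    have := (lt_div_iff₀ (GCG.specNorm_pos hA0)).1 ht.2
    rw [← div_eq_mul_inv, lt_div_iff₀ ht.1]
    linarith
  have hleast := GCG.exists_isLeast_errorBoundConstants (b := b) hA hA0 hτ hopt x0
  have hinv : ∀ ηs, IsLeast (GCG.errorBoundConstants A b τ x0) ηs → ∃ K P : ℕ,
      GCG.iterationBound n ηs η0 ρ ξ = (P * (1 + (K + n + 2) * (2 ^ n - 1)) : ℕ) ∧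
      ∀ k s, GCG.Reaches A b τ x0 t η0 ρ ξ ε k s →
        k ≤ P * (1 + (K + n + 2) * (2 ^ n - 1)) ∧ 0 ≤ s.etaHat ∧ 0 ≤ s.epsHat := by
    intro ηs hηs
    obtain ⟨K, hK, hKle⟩ := GCG.exists_runBound_eq n hη0 hηs.1.1 hξ
    obtain ⟨P, hP⟩ := Int.eq_ofNat_of_zero_le (zero_le_one.trans (GCG.one_le_phaseBound ηs η0 ρ))
    refine ⟨K, P, GCG.iterationBound_eq hP hK rfl, fun k s hs => ?_⟩
    obtain ⟨p, j, β, h⟩ :=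
      GCG.exists_loopInv hA hA0 hn hτ hopt ht.1 htL hη0 hρ hξ hε hηs.1 hKle rfl hs
    have hξ0 := hξ.1
    refine ⟨h.le_mul hn rfl ?_ fun q hq => ?_, hη0.le.trans (h.le_etaHat hη0 hρ), ?_⟩
    · exact_mod_cast hP ▸ GCG.one_le_phaseBound ηs η0 ρ
    · exact_mod_cast hP ▸ GCG.add_two_le_phaseBound hη0 hρ hq
    · rw [h.eps_eq]
      positivity
  have hstep : ∀ k s, GCG.Reaches A b τ x0 t η0 ρ ξ ε k s → ¬ GCG.Stops A b τ ε s →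
      ∃ s', GCG.Step A b τ t ρ ξ ε s s' := by
    intro k s hs hrun
    obtain ⟨ηs, hηs⟩ := hleast
    obtain ⟨K, P, -, h⟩ := hinv ηs hηs
    obtain ⟨-, h1, h2⟩ := h k s hs
    exact GCG.exists_step hA hτ hopt ht.1 ρ ξ hε h1 h2 hrun
  refine ⟨hleast, fun k s hs hrun => ?_, fun ηs hηs => ?_, ?_⟩
  · obtain ⟨s', hs'⟩ := hstep k s hs hrun
    exact ⟨s', hs', fun s'' hs'' => GCG.Step.unique hτ ht.1 hs'' hs'⟩
  · obtain ⟨K, P, hbound, h⟩ := hinv ηs hηs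
    rw [hbound]
    -- The count bounds every reachable state, so a method that never stopped within the bound would
    -- reach one pass too many.
    by_contra! hnot
    have hreach : ∀ k, ∃ s, GCG.Reaches A b τ x0 t η0 ρ ξ ε k s := by
      intro k
      induction k with
      | zero => exact ⟨_, .init⟩
      | succ k ih =>
        obtain ⟨s, hs⟩ := ih
        have hk := (h k s hs).1
        obtain ⟨s', hs'⟩ := hstep k s hs fun hterm =>
          absurd (hnot k s.x ⟨s, hs, hterm, rfl⟩) (not_lt.2 (by exact_mod_cast hk))
        exact ⟨s', .step k s s' hs hs'⟩
    obtain ⟨s, hs⟩ := hreach (P * (1 + (K + n + 2) * (2 ^ n - 1)) + 1)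
    have := (h _ s hs).1
    omega
  · rintro k _ ⟨s, -, hterm, rfl⟩
    refine ⟨⟨_, GCG.minSubgrad_mem_subdiff hA hτ s.x, hterm⟩, fun h0 => ?_⟩
    refine GCG.isOptimal_of_minSubgrad_eq_zero hA hτ (norm_le_zero_iff.1 ?_)
    exact h0 ▸ hterm
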